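/- Let $k,l\ge 2$ be integers. Call a set $\mathcal G\subseteq \mathrm{SU}(n)$ universal if the group generated by $\mathcal G$ is dense in $\mathrm{SU}(n)$ (in the operator norm topology). Let $\mathcal S_k\subseteq \mathrm{SU}(k)$ and $\mathcal S_l\subseteq\mathrm{SU}(l)$ be universal, let $V\in\mathrm{SU}(kl)$, acting on $\mathbb C^k\otimes\mathbb C^l$, and put $$\mathcal S=(\mathcal S_k\otimes\{I\})\cup(\{I\}\otimes\mathcal S_l)\cup\{V\}\subseteq \mathrm{SU}(kl).$$ 1. If $k\ne l$, then $\mathcal S$ is universal if and only if $V$ is not of the form $U_1\otimes U_2$ with unitary matrices $U_1\in\mathrm U(k)$, $U_2\in\mathrm U(l)$. If moreover $\gcd(k,l)=1$, then $\mathcal S$ is universal if and only if $V\notin \mathrm{SU}(k)\otimes\mathrm{SU}(l)=\{U_1\otimes U_2 : U_1\in\mathrm{SU}(k),\,U_2\in\mathrm{SU}(l)\}$. 2. If $k=l$, then $\mathcal S$ is universal if and only if $V$ is neither of the form $U_1\otimes U_2$ nor of the form $(U_1\otimes U_2)\cdot\mathrm{SWAP}$ with $U_1,U_2\in\mathrm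 U(k)$, where $\mathrm{SWAP}(u\otimes v)=v\otimes u$. -/

import Mathlib

open scoped Kronecker

/-- A set `S` of gates in `SU(n)` (`n` a finite index type of the computational basis) is universal
if the subgroup it generates is dense in `SU(n)`. The topology is the subspace topology of the
matrix space `Mₙ(ℂ)`, which is the topology of the operator norm (or of any other norm). -/
def IsUniversal {n : Type*} [Fintype n] [DecidableEq n]
    (S : Set (Matrix.specialUnitaryGroup n ℂ)) : Prop :=
  Dense (Subgroup.closure S : Set (Matrix.specialUnitaryGroup n ℂ))

/-- The tensor product `A ⊗ B ∈ SU(mn)` of `A ∈ SU(m)` and `B ∈ SU(n)`, as a Kronecker product;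
the basis of `ℂᵐ ⊗ ℂⁿ` is indexed by the product of the two index types. -/
def tensorSU {m n : Type*} [Fintype m] [DecidableEq m] [Fintype n] [DecidableEq n]
    (A : Matrix.specialUnitaryGroup m ℂ) (B : Matrix.specialUnitaryGroup n ℂ) :
    Matrix.specialUnitaryGroup (m × n) ℂ :=
  ⟨(A : Matrix m m ℂ) ⊗ₖ (B : Matrix n n ℂ), Matrix.mem_specialUnitaryGroup_iff.2
    ⟨Matrix.kronecker_mem_unitary A.2.1 B.2.1, by
      rw [Matrix.det_kronecker, (Matrix.mem_specialUnitaryGroup_iff.1 A.2).2,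
        (Matrix.mem_specialUnitaryGroup_iff.1 B.2).2, one_pow, one_pow, mul_one]⟩⟩

/-- The gate set `(S ⊗ {I}) ∪ ({I} ⊗ T) ∪ {V}` on the composite system. -/
def compositeGates {m n : Type*} [Fintype m] [DecidableEq m] [Fintype n] [DecidableEq n]
    (S : Set (Matrix.specialUnitaryGroup m ℂ)) (T : Set (Matrix.specialUnitaryGroup n ℂ))
    (V : Matrix.specialUnitaryGroup (m × n) ℂ) :
    Set (Matrix.specialUnitaryGroup (m × n) ℂ) :=
  ((fun A => tensorSU A 1) '' S) ∪ ((fun B => tensorSU 1 B) '' T) ∪ {V}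

/-- The SWAP operator on `ℂⁿ ⊗ ℂⁿ`, `u ⊗ v ↦ v ⊗ u`. -/
def swapMatrix (n : Type*) [DecidableEq n] : Matrix (n × n) (n × n) ℂ :=
  Matrix.of fun i j => if i = j.swap then 1 else 0

/-- `V = U₁ ⊗ U₂` for some unitary `U₁` and `U₂`. -/
def IsLocalProduct {m n : Type*} [Fintype m] [DecidableEq m] [Fintype n] [DecidableEq n]
    (V : Matrix (m × n) (m × n) ℂ) : Prop :=
  ∃ U₁ ∈ Matrix.unitaryGroup m ℂ, ∃ U₂ ∈ Matrix.unitaryGroup n ℂ, V = U₁ ⊗ₖ U₂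

/-- `V = (U₁ ⊗ U₂) · SWAP` for some unitary `U₁` and `U₂`. -/
def IsLocalProductSwap {n : Type*} [Fintype n] [DecidableEq n]
    (V : Matrix (n × n) (n × n) ℂ) : Prop :=
  ∃ U₁ ∈ Matrix.unitaryGroup n ℂ, ∃ U₂ ∈ Matrix.unitaryGroup n ℂ,
    V = (U₁ ⊗ₖ U₂) * swapMatrix n

/-!
The proof replaces the gate set by the closure `G` of the group it generates, a closed subgroup of
`SU(kl)` that contains `SU(k) ⊗ I`, `I ⊗ SU(l)` and `V`, and shows that `G` is everything unless
`V` normalizes the space `L = M_k ⊗ I + I ⊗ M_l` of local operators (`eq_top_of_not_normalizes`).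

The traceless skew-Hermitian `X` with `exp (tX) ∈ G` for all real `t` form a real Lie algebra
(`lieSubspace`): it is closed under addition by the Lie product formula, and under brackets because
it is stable under the adjoint action of `G`. Its complexification together with the scalars is
a complex space `W ⊇ L` that is stable under commutators with `L` and under conjugation by `V`. The
action of `L` leaves no room strictly between `L` and the full matrix algebra
(`le_localSubspace_or_eq_top`), so either `V` normalizes `L`, or `W` is everything. In the
latter case the Lie algebra is all of `𝔰𝔲(kl)`, and since every element of `SU(kl)` is a product of
two exponentials of elements of `𝔰𝔲(kl)` (`exists_exp_mul_exp_eq`), `G = SU(kl)`. No structure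
theory of Lie groups is used.

A unitary `V` normalizing `L` is a local product, or a local product times `SWAP`
(`tensor_or_swap_of_normalizes`). Indeed, if `V (A ⊗ I) V* = a ⊗ I + I ⊗ b`, then squaring gives a
local operator again, so the cross term `a ⊗ b` is local, which makes `a` or `b` scalar. Hence
conjugation by `V` maps each tensor factor into one of the two factors, and not both into the same
one. Either way the images of the matrix units `E_{ij} ⊗ E_{pq}` are pure tensors, and so is `V` up
to an exchange of the factors, which is possible only in equal dimensions.

Conversely, the normalizer of `L` is a closed proper subgroup of `SU(kl)` containing all local
gates, local products and, for `k = l`, their products with `SWAP`.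
-/

/-! ### The Lie algebra of a closed matrix group -/

section Lie

open NormedSpace Filter Topology

theorem norm_pow_sub_pow_le_nsmul {A : Type*} [NormedRing A] [NormOneClass A] {a b : A}
    (ha : ‖a‖ ≤ 1) (hb : ‖b‖ ≤ 1) (n : ℕ) : ‖a ^ n - b ^ n‖ ≤ n * ‖a - b‖ := by
  induction n with
  | zero => simp
  | succ n ih =>
    have h : a ^ (n + 1) - b ^ (n + 1) = (a ^ n - b ^ n) * a + b ^ n * (a - b) := by
      rw [pow_succ, pow_succ]; noncomm_ring
    have hbn : ‖b ^ n‖ ≤ 1 := (norm_pow_le b n).trans (pow_le_one₀ (norm_nonneg _) hb)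
    calc ‖a ^ (n + 1) - b ^ (n + 1)‖
        ≤ ‖a ^ n - b ^ n‖ * ‖a‖ + ‖b ^ n‖ * ‖a - b‖ := by
          rw [h]; exact (norm_add_le _ _).trans (add_le_add (norm_mul_le _ _) (norm_mul_le _ _))
      _ ≤ n * ‖a - b‖ * 1 + 1 * ‖a - b‖ := by gcongr
      _ = (n + 1 : ℕ) * ‖a - b‖ := by push_cast; ring

/-- The Lie product formula for elements that generate one-parameter groups of contractions. -/
theorem tendsto_exp_mul_exp_pow {A : Type*} [NormedRing A] [NormOneClass A] [NormedAlgebra ℝ A]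
    [CompleteSpace A] {X Y : A} (hX : ∀ t : ℝ, ‖exp (t • X)‖ ≤ 1)
    (hY : ∀ t : ℝ, ‖exp (t • Y)‖ ≤ 1) (hXY : ∀ t : ℝ, ‖exp (t • (X + Y))‖ ≤ 1) :
    Tendsto (fun n : ℕ => (exp ((n : ℝ)⁻¹ • X) * exp ((n : ℝ)⁻¹ • Y)) ^ n) atTop
      (𝓝 (exp (X + Y))) := by
  set f : ℝ → A := fun t => exp (t • X) * exp (t • Y) - exp (t • (X + Y)) with hf
  have hd : HasDerivAt f 0 0 := by
    have h := ((hasDerivAt_exp_smul_const (𝕂 := ℝ) X (0 : ℝ)).mul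
      (hasDerivAt_exp_smul_const (𝕂 := ℝ) Y (0 : ℝ))).sub
      (hasDerivAt_exp_smul_const (𝕂 := ℝ) (X + Y) (0 : ℝ))
    have h0 : exp ((0 : ℝ) • X) * X * exp ((0 : ℝ) • Y) + exp ((0 : ℝ) • X) *
        (exp ((0 : ℝ) • Y) * Y) - exp ((0 : ℝ) • (X + Y)) * (X + Y) = 0 := by
      simp
    rwa [h0] at h
  have hlim : Tendsto (fun n : ℕ => (n : ℝ)⁻¹) atTop (𝓝[≠] 0) := by
    refine tendsto_nhdsWithin_iff.2 ⟨tendsto_inv_atTop_nhds_zero_nat, ?_⟩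
    filter_upwards [eventually_gt_atTop 0] with n hn
    simpa using hn.ne'
  have hs := (hd.tendsto_slope_zero.comp hlim).norm
  rw [norm_zero] at hs
  rw [tendsto_iff_norm_sub_tendsto_zero]
  refine squeeze_zero' (Eventually.of_forall fun _ => norm_nonneg _) ?_ hs
  filter_upwards [eventually_gt_atTop 0] with n hn
  have hn' : (n : ℝ) ≠ 0 := by exact_mod_cast hn.ne'
  have hpow : exp (X + Y) = exp ((n : ℝ)⁻¹ • (X + Y)) ^ n := by
    let _ : NormedAlgebra ℚ A := NormedAlgebra.restrictScalars ℚ ℝ A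
    rw [← exp_nsmul, ← Nat.cast_smul_eq_nsmul ℝ, smul_smul, mul_inv_cancel₀ hn', one_smul]
  rw [hpow]
  -- Telescoping bounds the error by `n * ‖f (1/n)‖`, which tends to `‖f' 0‖ = 0`.
  refine (norm_pow_sub_pow_le_nsmul ?_ (hXY _) n).trans (le_of_eq ?_)
  · exact (norm_mul_le _ _).trans (mul_le_one₀ (hX _) (norm_nonneg _) (hY _))
  · simp [hf, norm_smul]

theorem Matrix.conjTranspose_real_smul_eq_neg {n : Type*} {X : Matrix n n ℂ}
    (hX : X.conjTranspose = -X) (t : ℝ) :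
    (t • X).conjTranspose = -(t • X) := by
  rw [Matrix.conjTranspose_smul, hX, star_trivial, smul_neg]

variable {n : Type*} [Fintype n] [DecidableEq n]

theorem Matrix.exp_mem_unitaryGroup {X : Matrix n n ℂ} (hX : X.conjTranspose = -X) :
    exp X ∈ Matrix.unitaryGroup n ℂ := by
  open scoped Matrix.Norms.L2Operator in
  let _ : NormedAlgebra ℚ (Matrix n n ℂ) := NormedAlgebra.restrictScalars ℚ ℂ _
  exact exp_mem_unitary_of_mem_skewAdjoint (skewAdjoint.mem_iff.2 hX)

theorem Matrix.tendsto_exp_mul_exp_pow [Nonempty n] {X Y : Matrix n n ℂ}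
    (hX : X.conjTranspose = -X) (hY : Y.conjTranspose = -Y) :
    Tendsto (fun k : ℕ => (exp ((k : ℝ)⁻¹ • X) * exp ((k : ℝ)⁻¹ • Y)) ^ k) atTop
      (𝓝 (exp (X + Y))) := by
  open scoped Matrix.Norms.L2Operator in
  have key : ∀ Z : Matrix n n ℂ, Z.conjTranspose = -Z → ∀ t : ℝ, ‖exp (t • Z)‖ ≤ 1 :=
    fun Z hZ t => (CStarRing.norm_of_mem_unitary
      (Matrix.exp_mem_unitaryGroup (Matrix.conjTranspose_real_smul_eq_neg hZ t))).le
  refine _root_.tendsto_exp_mul_exp_pow (key X hX) (key Y hY) (key _ ?_)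
  rw [Matrix.conjTranspose_add, hX, hY, neg_add]

/-- The Lie algebra of a closed submonoid `K` of `Mₙ(ℂ)`, cut down to `𝔰𝔲(n)`: the traceless
skew-Hermitian matrices whose one-parameter group lies in `K`. -/
def lieSubspace [Nonempty n] (K : Submonoid (Matrix n n ℂ))
    (hK : IsClosed (K : Set (Matrix n n ℂ))) : Submodule ℝ (Matrix n n ℂ) where
  carrier := {X | X.conjTranspose = -X ∧ X.trace = 0 ∧ ∀ t : ℝ, exp (t • X) ∈ K}
  zero_mem' := by simp
  add_mem' := by
    rintro X Y ⟨hX, hX0, hXK⟩ ⟨hY, hY0, hYK⟩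
    refine ⟨by rw [Matrix.conjTranspose_add, hX, hY, neg_add], by simp [hX0, hY0], fun t => ?_⟩
    rw [smul_add]
    refine hK.mem_of_tendsto (Matrix.tendsto_exp_mul_exp_pow
      (Matrix.conjTranspose_real_smul_eq_neg hX t) (Matrix.conjTranspose_real_smul_eq_neg hY t))
      (Eventually.of_forall fun k => K.pow_mem (K.mul_mem ?_ ?_) k)
    · rw [smul_smul]; exact hXK _
    · rw [smul_smul]; exact hYK _
  smul_mem' := by
    rintro c X ⟨hX, hX0, hXK⟩
    refine ⟨Matrix.conjTranspose_real_smul_eq_neg hX c, by simp [hX0], fun t => ?_⟩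
    rw [smul_smul]; exact hXK _

theorem mem_lieSubspace [Nonempty n] {K : Submonoid (Matrix n n ℂ)}
    {hK : IsClosed (K : Set (Matrix n n ℂ))} {X : Matrix n n ℂ} :
    X ∈ lieSubspace K hK ↔
      X.conjTranspose = -X ∧ X.trace = 0 ∧ ∀ t : ℝ, exp (t • X) ∈ K := Iff.rfl

/-- The Lie algebra is stable under the adjoint action of unitaries in `K`. -/
theorem conj_mem_lieSubspace [Nonempty n] {K : Submonoid (Matrix n n ℂ)}
    {hK : IsClosed (K : Set (Matrix n n ℂ))} {U X : Matrix n n ℂ}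
    (hU : U ∈ Matrix.unitaryGroup n ℂ) (hUK : U ∈ K) (hUK' : U.conjTranspose ∈ K)
    (hX : X ∈ lieSubspace K hK) : U * X * U.conjTranspose ∈ lieSubspace K hK := by
  obtain ⟨h1, h2, h3⟩ := hX
  have hUU : U.conjTranspose * U = 1 := Matrix.mem_unitaryGroup_iff'.1 hU
  have hinv : U⁻¹ = U.conjTranspose := Matrix.inv_eq_left_inv hUU
  refine ⟨?_, ?_, fun t => ?_⟩
  · simp [Matrix.conjTranspose_mul, h1, Matrix.mul_assoc]
  · rw [Matrix.trace_mul_comm, ← Matrix.mul_assoc, hUU, Matrix.one_mul, h2]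
  · have h : t • (U * X * U.conjTranspose) = U * (t • X) * U⁻¹ := by
      rw [hinv, Matrix.mul_smul, Matrix.smul_mul]
    rw [h, Matrix.exp_conj _ _ (IsUnit.of_mul_eq_one_right _ hUU), hinv]
    exact K.mul_mem (K.mul_mem hUK (h3 t)) hUK'

/-- The Lie algebra is closed under the bracket: `⁅X, Y⁆` is the derivative at `0` of
`t ↦ exp (tX) Y exp (-tX)`. -/
theorem commutator_mem_lieSubspace [Nonempty n] {K : Submonoid (Matrix n n ℂ)}
    {hK : IsClosed (K : Set (Matrix n n ℂ))} {X Y : Matrix n n ℂ}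
    (hX : X ∈ lieSubspace K hK) (hY : Y ∈ lieSubspace K hK) :
    X * Y - Y * X ∈ lieSubspace K hK := by
  open scoped Matrix.Norms.L2Operator in
  have hmem : ∀ t : ℝ, exp (t • X) * Y * exp (t • -X) ∈ lieSubspace K hK := by
    intro t
    have hs := Matrix.conjTranspose_real_smul_eq_neg hX.1 t
    have hc : (exp (t • X)).conjTranspose = exp (t • -X) := by
      rw [← Matrix.exp_conjTranspose, hs, smul_neg]
    rw [← hc]
    refine conj_mem_lieSubspace (Matrix.exp_mem_unitaryGroup hs) (hX.2.2 t) ?_ hY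
    rw [hc, smul_neg, ← neg_smul]
    exact hX.2.2 (-t)
  have hd : HasDerivAt (fun t : ℝ => exp (t • X) * Y * exp (t • -X)) (X * Y - Y * X) 0 := by
    have h := ((hasDerivAt_exp_smul_const (𝕂 := ℝ) X (0 : ℝ)).mul_const Y).mul
      (hasDerivAt_exp_smul_const (𝕂 := ℝ) (-X) (0 : ℝ))
    have h0 : exp ((0 : ℝ) • X) * X * Y * exp ((0 : ℝ) • -X) + exp ((0 : ℝ) • X) * Y *
        (exp ((0 : ℝ) • -X) * -X) = X * Y - Y * X := by
      simp [sub_eq_add_neg]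
    rwa [h0] at h
  refine (Submodule.closed_of_finiteDimensional (lieSubspace K hK)).mem_of_tendsto
    hd.tendsto_slope_zero (Eventually.of_forall fun t => Submodule.smul_mem _ _ ?_)
  exact Submodule.sub_mem _ (hmem _) (hmem _)

end Lie

/-! ### Local operators and subspaces stable under them -/

section Algebra

open Matrix

variable {m n : Type*} [Fintype m] [DecidableEq m] [Fintype n] [DecidableEq n]

/-- A subspace stable under `ad T` with `T² = 0` is stable under `X ↦ T X T`, since
`(ad T)² X = -2 T X T`. -/
theorem mul_mul_mem_of_commutator_mem {R : Type*} [Ring R] [Algebra ℂ R] {L : Submodule ℂ R}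
    {T X : R} (hT : T * T = 0) (hL : ∀ X ∈ L, T * X - X * T ∈ L) (hX : X ∈ L) :
    T * X * T ∈ L := by
  have h : T * (T * X - X * T) - (T * X - X * T) * T = (-2 : ℂ) • (T * X * T) := by
    have h1 : T * (T * X) = 0 := by rw [← mul_assoc, hT, zero_mul]
    have h2 : X * T * T = 0 := by rw [mul_assoc, hT, mul_zero]
    rw [mul_sub, sub_mul, h1, h2, ← mul_assoc, neg_smul, two_smul]
    abel
  have h' := hL _ (hL _ hX)
  rw [h] at h'
  exact (L.smul_mem_iff (by norm_num)).1 h'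

theorem exists_eq_smul_one {m : Type*} [DecidableEq m] {Z : Matrix m m ℂ}
    (hoff : ∀ i j, i ≠ j → Z i j = 0) (hdiag : ∀ i j, Z i i = Z j j) : ∃ c : ℂ, Z = c • 1 := by
  rcases isEmpty_or_nonempty m with hm | ⟨⟨a⟩⟩
  · exact ⟨0, Subsingleton.elim _ _⟩
  · refine ⟨Z a a, ?_⟩
    ext i j
    by_cases hij : i = j
    · subst hij; simp [hdiag i a]
    · simp [hij, hoff i j hij]

/-- A Lie ideal of `Mₙ(ℂ)` that contains the identity and a non-scalar matrix is everything. -/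
theorem lieIdeal_eq_top {L : Submodule ℂ (Matrix m m ℂ)} (h1 : 1 ∈ L)
    (hL : ∀ A, ∀ X ∈ L, A * X - X * A ∈ L) {Z : Matrix m m ℂ} (hZ : Z ∈ L)
    (hZs : ∀ c : ℂ, Z ≠ c • 1) : L = ⊤ := by
  -- A non-zero entry at `(i, j)` puts the matrix unit `E_{ji}` into `L`.
  have hsand : ∀ i j, i ≠ j → ∀ X ∈ L, X i j ≠ 0 → single j i (1 : ℂ) ∈ L := by
    intro i j hij X hX hx
    have h := mul_mul_mem_of_commutator_mem (T := single j i (1 : ℂ))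
      (by simp [hij]) (hL _) hX
    rw [single_mul_mul_single, one_mul, mul_one] at h
    have h2 : single j i (X i j) = X i j • single j i (1 : ℂ) := by simp
    rw [h2] at h
    exact (L.smul_mem_iff hx).1 h
  obtain ⟨i, j, hij, hE⟩ : ∃ i j, i ≠ j ∧ single i j (1 : ℂ) ∈ L := by
    by_contra! hcon
    have hoff : ∀ X ∈ L, ∀ i j, i ≠ j → X i j = 0 := fun X hX i j hij => by
      by_contra hx
      exact hcon j i hij.symm (hsand i j hij X hX hx)
    have hdiag : ∀ i j, Z i i = Z j j := by
      intro i j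
      by_cases hij : i = j
      · rw [hij]
      have h := hoff _ (hL (single i j 1) Z hZ) i j hij
      simp only [Matrix.sub_apply, single_mul_apply_same, mul_single_apply_same, one_mul,
        mul_one] at h
      exact (sub_eq_zero.1 h).symm
    obtain ⟨c, hc⟩ := exists_eq_smul_one (hoff Z hZ) hdiag
    exact hZs c hc
  have hcol : ∀ k, k ≠ j → single k j (1 : ℂ) ∈ L := by
    intro k hk
    have h := hL (single k i 1) _ hE
    rwa [single_mul_single_same, single_mul_single_of_ne _ _ _ _ hk.symm, mul_one, sub_zero] at h
  have hoff : ∀ k l, k ≠ l → single k l (1 : ℂ) ∈ L := by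
    intro k l hkl
    by_cases hk : k = j
    · subst hk
      exact hsand l k hkl.symm _ (hcol l hkl.symm) (by simp)
    · have h := hL (single j l 1) _ (hcol k hk)
      rw [single_mul_single_same, single_mul_single_of_ne _ _ _ _ hkl.symm, mul_one, zero_sub] at h
      simpa using L.neg_mem h
  have hdd : ∀ k l, single k k (1 : ℂ) - single l l 1 ∈ L := by
    intro k l
    by_cases hkl : k = l
    · simp [hkl]
    have h := hL (single k l 1) _ (hoff l k (Ne.symm hkl))
    rwa [single_mul_single_same, single_mul_single_same, mul_one] at h
  have hall : ∀ k l, single k l (1 : ℂ) ∈ L := by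
    intro k l
    by_cases hkl : k = l
    · subst hkl
      -- The identity recovers the diagonal units from their differences.
      have h : (Fintype.card m : ℂ) • single k k (1 : ℂ) =
          1 + ∑ l, (single k k (1 : ℂ) - single l l 1) := by
        rw [Finset.sum_sub_distrib, sum_single_one]
        simp [← Nat.cast_smul_eq_nsmul ℂ]
      have hc : (Fintype.card m : ℂ) ≠ 0 := by
        have : Nonempty m := ⟨k⟩
        exact_mod_cast Fintype.card_ne_zero
      refine (L.smul_mem_iff hc).1 ?_
      rw [h]
      exact L.add_mem h1 (L.sum_mem fun l _ => hdd k l)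
    · exact hoff k l hkl
  rw [eq_top_iff]
  rintro X -
  rw [matrix_eq_sum_single X]
  refine L.sum_mem fun k _ => L.sum_mem fun l _ => ?_
  have h2 : single k l (X k l) = X k l • single k l (1 : ℂ) := by simp
  rw [h2]
  exact L.smul_mem _ (hall k l)

/-- The subspace `Mₘ ⊗ I + I ⊗ Mₙ` of local operators. -/
def localSubspace (m n : Type*) [Fintype m] [DecidableEq m] [Fintype n] [DecidableEq n] :
    Submodule ℂ (Matrix (m × n) (m × n) ℂ) where
  carrier := {X | ∃ (A : Matrix m m ℂ) (B : Matrix n n ℂ), X = A ⊗ₖ 1 + 1 ⊗ₖ B}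
  zero_mem' := ⟨0, 0, by simp⟩
  add_mem' := by
    rintro _ _ ⟨A, B, rfl⟩ ⟨A', B', rfl⟩
    exact ⟨A + A', B + B', by rw [add_kronecker, kronecker_add]; abel⟩
  smul_mem' := by
    rintro c _ ⟨A, B, rfl⟩
    exact ⟨c • A, c • B, by rw [smul_kronecker, kronecker_smul, smul_add]⟩

theorem mem_localSubspace {X : Matrix (m × n) (m × n) ℂ} :
    X ∈ localSubspace m n ↔
      ∃ (A : Matrix m m ℂ) (B : Matrix n n ℂ), X = A ⊗ₖ 1 + 1 ⊗ₖ B := Iff.rfl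

theorem kronecker_one_mem_localSubspace (A : Matrix m m ℂ) :
    A ⊗ₖ (1 : Matrix n n ℂ) ∈ localSubspace m n := ⟨A, 0, by simp⟩

theorem one_kronecker_mem_localSubspace (B : Matrix n n ℂ) :
    (1 : Matrix m m ℂ) ⊗ₖ B ∈ localSubspace m n := ⟨0, B, by simp⟩

theorem eq_top_of_forall_kronecker_mem {W : Submodule ℂ (Matrix (m × n) (m × n) ℂ)}
    (h : ∀ (A : Matrix m m ℂ) (B : Matrix n n ℂ), A ⊗ₖ B ∈ W) : W = ⊤ := by
  rw [eq_top_iff]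
  rintro X -
  rw [matrix_eq_sum_single X]
  refine W.sum_mem fun k _ => W.sum_mem fun l _ => ?_
  have h2 : single k l (X k l) = X k l • (single k.1 l.1 (1 : ℂ) ⊗ₖ single k.2 l.2 (1 : ℂ)) := by
    rw [single_kronecker_single]; simp
  rw [h2]
  exact W.smul_mem _ (h _ _)

theorem one_kronecker_single_mul_apply (X : Matrix (m × n) (m × n) ℂ) (q p : n) (i : m) (a : n)
    (y : m × n) :
    ((1 : Matrix m m ℂ) ⊗ₖ single q p (1 : ℂ) * X) (i, a) y = if q = a then X (i, p) y else 0 := by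
  by_cases h : q = a <;>
    simp [mul_apply, kroneckerMap_apply, Fintype.sum_prod_type, one_apply, single_apply, h]

theorem mul_one_kronecker_single_apply (X : Matrix (m × n) (m × n) ℂ) (q p : n) (j : m) (b : n)
    (x : m × n) :
    (X * (1 : Matrix m m ℂ) ⊗ₖ single q p (1 : ℂ)) x (j, b) = if p = b then X x (j, q) else 0 := by
  by_cases h : p = b <;>
    simp [mul_apply, kroneckerMap_apply, Fintype.sum_prod_type, one_apply, single_apply, h]

/-- If `X ⊗ Y ∈ W` with `X` and `Y` non-scalar, then `W` is everything: the left and the right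
slices of `W` are Lie ideals. -/
theorem eq_top_of_kronecker_mem {W : Submodule ℂ (Matrix (m × n) (m × n) ℂ)}
    (hW : localSubspace m n ≤ W)
    (hL : ∀ A : Matrix m m ℂ, ∀ X ∈ W, A ⊗ₖ 1 * X - X * A ⊗ₖ 1 ∈ W)
    (hR : ∀ B : Matrix n n ℂ, ∀ X ∈ W, 1 ⊗ₖ B * X - X * 1 ⊗ₖ B ∈ W)
    {X : Matrix m m ℂ} {Y : Matrix n n ℂ} (h : X ⊗ₖ Y ∈ W)
    (hX : ∀ c : ℂ, X ≠ c • 1) (hY : ∀ c : ℂ, Y ≠ c • 1) : W = ⊤ := by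
  have hleft : ∀ X', X' ⊗ₖ Y ∈ W := by
    let L : Submodule ℂ (Matrix m m ℂ) := W.comap ((kroneckerBilinear (R := ℂ) (α := ℂ)).flip Y)
    have hmem : ∀ X', X' ∈ L ↔ X' ⊗ₖ Y ∈ W := fun _ => Iff.rfl
    have : L = ⊤ := by
      refine lieIdeal_eq_top (L := L) (hW (one_kronecker_mem_localSubspace Y)) ?_ h hX
      intro A X' hX'
      have h := hL A _ ((hmem _).1 hX')
      have hc : A ⊗ₖ 1 * X' ⊗ₖ Y - X' ⊗ₖ Y * A ⊗ₖ (1 : Matrix n n ℂ) = (A * X' - X' * A) ⊗ₖ Y := by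
        rw [← mul_kronecker_mul, ← mul_kronecker_mul, Matrix.one_mul, Matrix.mul_one]
        ext ⟨i, p⟩ ⟨j, q⟩
        simp [kroneckerMap_apply, sub_mul]
      rwa [hmem, ← hc]
    intro X'
    rw [← hmem, this]
    trivial
  refine eq_top_of_forall_kronecker_mem fun X' Y' => ?_
  let R : Submodule ℂ (Matrix n n ℂ) := W.comap (kroneckerBilinear (R := ℂ) (α := ℂ) X')
  have hmem : ∀ Y', Y' ∈ R ↔ X' ⊗ₖ Y' ∈ W := fun _ => Iff.rfl
  have : R = ⊤ := by
    refine lieIdeal_eq_top (L := R) (hW (kronecker_one_mem_localSubspace X')) ?_ (hleft X') hY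
    intro B Y' hY'
    have h := hR B _ ((hmem _).1 hY')
    have hc : 1 ⊗ₖ B * X' ⊗ₖ Y' - X' ⊗ₖ Y' * (1 : Matrix m m ℂ) ⊗ₖ B = X' ⊗ₖ (B * Y' - Y' * B) := by
      rw [← mul_kronecker_mul, ← mul_kronecker_mul, Matrix.one_mul, Matrix.mul_one]
      ext ⟨i, p⟩ ⟨j, q⟩
      simp [kroneckerMap_apply, mul_sub]
    rwa [hmem, ← hc]
  rw [← hmem, this]
  trivial

/-- A subspace containing the local operators and stable under commutators with them consists of
local operators or is everything. If it is not everything, sandwiching with `I ⊗ E_{qp}`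
shows that all off-diagonal blocks of its elements are scalar; the commutator with
`I ⊗ E_{pq}` moves differences of diagonal blocks into off-diagonal position. -/
theorem le_localSubspace_or_eq_top {W : Submodule ℂ (Matrix (m × n) (m × n) ℂ)}
    (hW : localSubspace m n ≤ W)
    (hL : ∀ A : Matrix m m ℂ, ∀ X ∈ W, A ⊗ₖ 1 * X - X * A ⊗ₖ 1 ∈ W)
    (hR : ∀ B : Matrix n n ℂ, ∀ X ∈ W, 1 ⊗ₖ B * X - X * 1 ⊗ₖ B ∈ W) :
    W ≤ localSubspace m n ∨ W = ⊤ := by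
  rw [or_iff_not_imp_right]
  intro hne Z hZ
  have hblock : ∀ X ∈ W, ∀ p q, p ≠ q → ∃ c : ℂ,
      (Matrix.of fun i j => X (i, p) (j, q)) = c • (1 : Matrix m m ℂ) := by
    intro X hX p q hpq
    by_contra! hcon
    refine hne (eq_top_of_kronecker_mem hW hL hR (Y := single q p (1 : ℂ)) ?_ hcon ?_)
    · have h := mul_mul_mem_of_commutator_mem (T := (1 : Matrix m m ℂ) ⊗ₖ single q p (1 : ℂ))
        (by rw [← mul_kronecker_mul]; simp [hpq]) (hR _) hX
      convert h using 1
      ext ⟨i, a⟩ ⟨j, b⟩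
      rw [mul_one_kronecker_single_apply, one_kronecker_single_mul_apply, kroneckerMap_apply,
        single_apply]
      split_ifs <;> simp_all
    · intro c hc
      have := congrFun (congrFun hc q) p
      simp [hpq.symm] at this
  have hdiag : ∀ p q, ∃ c : ℂ,
      (Matrix.of fun i j => Z (i, p) (j, p) - Z (i, q) (j, q)) = c • (1 : Matrix m m ℂ) := by
    intro p q
    by_cases hpq : p = q
    · exact ⟨0, by ext; simp [hpq]⟩
    obtain ⟨c, hc⟩ := hblock _ (hR (single q p 1) Z hZ) q p (Ne.symm hpq)
    refine ⟨c, ?_⟩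
    rw [← hc]
    ext i j
    simp only [of_apply, Matrix.sub_apply, mul_one_kronecker_single_apply,
      one_kronecker_single_mul_apply, if_true]
  rcases isEmpty_or_nonempty n with hn | ⟨⟨r⟩⟩
  · exact ⟨0, 0, Subsingleton.elim _ _⟩
  have hex : ∀ p q, ∃ c : ℂ, ∀ i j, Z (i, p) (j, q) =
      (if p = q then Z (i, r) (j, r) else 0) + c * (1 : Matrix m m ℂ) i j := by
    intro p q
    by_cases hpq : p = q
    · subst hpq
      obtain ⟨c, hc⟩ := hdiag p r
      refine ⟨c, fun i j => ?_⟩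
      have := congrFun (congrFun hc i) j
      simp only [of_apply, Matrix.smul_apply, smul_eq_mul] at this
      simp [← this]
    · obtain ⟨c, hc⟩ := hblock Z hZ p q hpq
      refine ⟨c, fun i j => ?_⟩
      have := congrFun (congrFun hc i) j
      simp only [of_apply, Matrix.smul_apply, smul_eq_mul] at this
      simp [← this, hpq]
  choose B hB using hex
  refine ⟨Matrix.of fun i j => Z (i, r) (j, r), Matrix.of B, ?_⟩
  ext ⟨i, p⟩ ⟨j, q⟩
  rw [hB]
  simp [kroneckerMap_apply, one_apply, mul_comm]

end Algebra

/-! ### Unitaries that normalize the local operators -/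

section Normalizer

open Matrix

theorem Submodule.eq_top_or_eq_top_of_forall_mem {R M : Type*} [Ring R] [AddCommGroup M]
    [Module R M] {P Q : Submodule R M} (h : ∀ x, x ∈ P ∨ x ∈ Q) : P = ⊤ ∨ Q = ⊤ := by
  by_contra! hne
  obtain ⟨x, hx⟩ : ∃ x, x ∉ P := by simpa [Submodule.eq_top_iff'] using hne.1
  obtain ⟨y, hy⟩ : ∃ y, y ∉ Q := by simpa [Submodule.eq_top_iff'] using hne.2
  have hxQ := (h x).resolve_left hx
  have hyP := (h y).resolve_right hy
  rcases h (x + y) with hxy | hxy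
  · exact hx ((P.add_mem_iff_left hyP).1 hxy)
  · exact hy ((Q.add_mem_iff_right hxQ).1 hxy)

/-- If `X ⊗ Y = I`, then both factors are scalar. -/
theorem exists_smul_one_of_kronecker_eq_one {m n : Type*} [DecidableEq m] [DecidableEq n]
    [Nonempty m] [Nonempty n] {X : Matrix m m ℂ} {Y : Matrix n n ℂ} (h : X ⊗ₖ Y = 1) :
    ∃ c : ℂ, c ≠ 0 ∧ X = c • 1 ∧ Y = c⁻¹ • 1 := by
  obtain ⟨a⟩ := ‹Nonempty m›
  obtain ⟨b⟩ := ‹Nonempty n›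
  have hent : ∀ i j p q, X i j * Y p q = (1 : Matrix m m ℂ) i j * (1 : Matrix n n ℂ) p q := by
    intro i j p q
    have := congrFun (congrFun h (i, p)) (j, q)
    rw [← one_kronecker_one] at this
    simpa only [kroneckerMap_apply] using this
  have hab : X a a * Y b b = 1 := by simpa using hent a a b b
  have hX : X a a ≠ 0 := left_ne_zero_of_mul_eq_one hab
  have hY : Y b b = (X a a)⁻¹ := eq_inv_of_mul_eq_one_right hab
  refine ⟨X a a, hX, ?_, ?_⟩
  · ext i j
    have := hent i j b b
    rw [hY, ← div_eq_mul_inv, div_eq_iff hX] at this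
    simp [this, mul_comm]
  · ext p q
    have := hent a a p q
    rw [one_apply_eq, one_mul] at this
    rw [Matrix.smul_apply, ← this, smul_eq_mul, inv_mul_cancel_left₀ hX]

theorem card_le_of_mul_conjTranspose_eq_smul_one {m n : Type*} [Fintype m] [Fintype n]
    [DecidableEq m] {M : Matrix m n ℂ} {c : ℂ} (hc : c ≠ 0)
    (h : M * Mᴴ = c • 1) : Fintype.card m ≤ Fintype.card n := by
  have h1 : M * (c⁻¹ • Mᴴ) = 1 := by
    rw [Matrix.mul_smul, h, smul_smul, inv_mul_cancel₀ hc, one_smul]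
  have := rank_mul_le_left M (c⁻¹ • Mᴴ)
  rw [h1, rank_one] at this
  exact this.trans (rank_le_card_width M)

variable {m n : Type*} [Fintype m] [DecidableEq m] [Fintype n] [DecidableEq n]

theorem scalar_of_kronecker_mem_localSubspace {A : Matrix m m ℂ} {B : Matrix n n ℂ}
    (h : A ⊗ₖ B ∈ localSubspace m n) : (∃ c : ℂ, A = c • 1) ∨ ∃ c : ℂ, B = c • 1 := by
  obtain ⟨A', B', h⟩ := h
  have hent : ∀ i j p q, A i j * B p q =
      A' i j * (1 : Matrix n n ℂ) p q + (1 : Matrix m m ℂ) i j * B' p q := fun i j p q => by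
    simpa only [Matrix.add_apply, kroneckerMap_apply] using congrFun (congrFun h (i, p)) (j, q)
  rw [or_iff_not_imp_left]
  intro hA
  refine exists_eq_smul_one (fun p q hpq => ?_) fun p q => ?_
  · by_contra hB
    refine hA ⟨B' p q / B p q, ?_⟩
    ext i j
    have := hent i j p q
    rw [one_apply_ne hpq, mul_zero, zero_add] at this
    rw [Matrix.smul_apply, smul_eq_mul, eq_comm, div_mul_eq_mul_div, div_eq_iff hB, this, mul_comm]
  · by_contra hB
    have hB := sub_ne_zero.2 hB
    refine hA ⟨(B' p p - B' q q) / (B p p - B q q), ?_⟩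
    ext i j
    have h1 := hent i j p p
    have h2 := hent i j q q
    rw [one_apply_eq] at h1 h2
    rw [Matrix.smul_apply, smul_eq_mul, eq_comm, div_mul_eq_mul_div, div_eq_iff hB]
    linear_combination h2 - h1

/-- An element of `Mₘ ⊗ I + I ⊗ Mₙ` whose square is again of this form lies in one of the two
summands, because `(a ⊗ I + I ⊗ b)²` contains the cross term `2 a ⊗ b`. -/
theorem local_of_sq_mem_localSubspace {X : Matrix (m × n) (m × n) ℂ}
    (hX : X ∈ localSubspace m n) (hX2 : X * X ∈ localSubspace m n) :
    (∃ A : Matrix m m ℂ, X = A ⊗ₖ 1) ∨ ∃ B : Matrix n n ℂ, X = 1 ⊗ₖ B := by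
  obtain ⟨A, B, rfl⟩ := hX
  have hcross : (A ⊗ₖ 1 + 1 ⊗ₖ B) * (A ⊗ₖ 1 + 1 ⊗ₖ B) =
      ((A * A) ⊗ₖ 1 + 1 ⊗ₖ (B * B)) + (2 : ℂ) • A ⊗ₖ B := by
    rw [add_mul, mul_add, mul_add]
    simp only [← mul_kronecker_mul, Matrix.one_mul, Matrix.mul_one]
    rw [two_smul]; abel
  rw [hcross, Submodule.add_mem_iff_right _ (mem_localSubspace.2 ⟨A * A, B * B, rfl⟩),
    Submodule.smul_mem_iff _ (by norm_num)] at hX2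
  rcases scalar_of_kronecker_mem_localSubspace hX2 with ⟨c, rfl⟩ | ⟨c, rfl⟩
  · right
    exact ⟨c • 1 + B, by rw [kronecker_add, smul_kronecker, kronecker_smul]⟩
  · left
    exact ⟨A + c • 1, by rw [add_kronecker, smul_kronecker, kronecker_smul]⟩

theorem conj_mul_conj {V : Matrix m m ℂ} (hV : Vᴴ * V = 1) (X Y : Matrix m m ℂ) :
    V * X * Vᴴ * (V * Y * Vᴴ) = V * (X * Y) * Vᴴ := by
  have : V * X * Vᴴ * (V * Y * Vᴴ) = V * X * (Vᴴ * V) * Y * Vᴴ := by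
    simp only [Matrix.mul_assoc]
  rw [this, hV, Matrix.mul_one, Matrix.mul_assoc V X Y]

/-- If the linear map `f` from a matrix algebra preserves squares and takes local values, then the
values all lie in the first summand or all lie in the second. -/
theorem forall_left_or_forall_right {k : Type*} [Fintype k] [DecidableEq k]
    (f : Matrix k k ℂ →ₗ[ℂ] Matrix (m × n) (m × n) ℂ)
    (hf : ∀ X, f X ∈ localSubspace m n) (hsq : ∀ X, f X * f X = f (X * X)) :
    (∀ X, ∃ A : Matrix m m ℂ, f X = A ⊗ₖ 1) ∨ ∀ X, ∃ B : Matrix n n ℂ, f X = 1 ⊗ₖ B := by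
  let P := (LinearMap.range ((kroneckerBilinear (R := ℂ) (α := ℂ) (l := m) (m := m)
    (n := n) (p := n)).flip 1)).comap f
  let Q := (LinearMap.range (kroneckerBilinear (R := ℂ) (α := ℂ) (l := m) (m := m)
    (n := n) (p := n) 1)).comap f
  have hP : ∀ X, X ∈ P ↔ ∃ A : Matrix m m ℂ, f X = A ⊗ₖ 1 := fun X =>
    exists_congr fun A => eq_comm
  have hQ : ∀ X, X ∈ Q ↔ ∃ B : Matrix n n ℂ, f X = 1 ⊗ₖ B := fun X =>
    exists_congr fun A => eq_comm
  have h := Submodule.eq_top_or_eq_top_of_forall_mem (P := P) (Q := Q) fun X => by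
    rw [hP, hQ]
    exact local_of_sq_mem_localSubspace (hf X) (hsq X ▸ hf _)
  exact h.imp (fun (h : P = ⊤) X => (hP X).1 (h ▸ Submodule.mem_top)) fun (h : Q = ⊤) X =>
    (hQ X).1 (h ▸ Submodule.mem_top)

theorem mul_single_mul_conjTranspose_apply (V : Matrix m m ℂ) (x y u v : m) :
    (V * single x y (1 : ℂ) * Vᴴ) u v = V u x * star (V v y) := by
  simp [mul_apply, single_apply, ite_and, Finset.sum_ite_eq]

theorem exists_apply_ne_zero_of_conjTranspose_mul_self {V : Matrix m m ℂ} (hV : Vᴴ * V = 1)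
    (y : m) : ∃ v, V v y ≠ 0 := by
  by_contra! h
  have := congrFun (congrFun hV y) y
  simp [mul_apply, h] at this

/-- A unitary normalizing the local operators maps each of the two tensor factors onto itself or
interchanges them. In the first case it is a pure tensor, in the second case it is a pure tensor
of rectangular matrices preceded by the exchange of the factors. -/
theorem tensor_or_swap_of_normalizes [Nontrivial m] [Nontrivial n]
    {V : Matrix (m × n) (m × n) ℂ} (hV : V ∈ unitaryGroup (m × n) ℂ)
    (hN : ∀ X ∈ localSubspace m n, V * X * Vᴴ ∈ localSubspace m n) :
    (∃ (M : Matrix m m ℂ) (N : Matrix n n ℂ), V = M ⊗ₖ N) ∨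
      ∃ (M : Matrix m n ℂ) (N : Matrix n m ℂ), V.submatrix id Prod.swap = M ⊗ₖ N := by
  have hVV : Vᴴ * V = 1 := mem_unitaryGroup_iff'.1 hV
  have hVV' : V * Vᴴ = 1 := mem_unitaryGroup_iff.1 hV
  obtain ⟨i₀, i₁, hi⟩ := exists_pair_ne m
  obtain ⟨p₀, p₁, hp⟩ := exists_pair_ne n
  let φ := LinearMap.mulLeftRight ℂ (V, Vᴴ)
  have hφ : ∀ X, φ X = V * X * Vᴴ := fun X => rfl
  have hmul : ∀ X Y, φ X * φ Y = φ (X * Y) := fun X Y => conj_mul_conj hVV X Y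
  have hsurj : ∀ Y, φ (Vᴴ * Y * V) = Y := by
    intro Y
    have : φ (Vᴴ * Y * V) = (V * Vᴴ) * Y * (V * Vᴴ) := by
      simp only [hφ, Matrix.mul_assoc]
    rw [this, hVV', Matrix.one_mul, Matrix.mul_one]
  have hten : ∀ (A : Matrix m m ℂ) (B : Matrix n n ℂ), φ (A ⊗ₖ B) = φ (A ⊗ₖ 1) * φ (1 ⊗ₖ B) := by
    intro A B
    rw [hmul, ← mul_kronecker_mul, Matrix.one_mul, Matrix.mul_one]
  obtain ⟨⟨v₁, v₂⟩, hv⟩ := exists_apply_ne_zero_of_conjTranspose_mul_self hVV (i₀, p₀)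
  have hv' : star (V (v₁, v₂) (i₀, p₀)) ≠ 0 := by simpa using hv
  -- The entries of `V` are read off from the images of the rank one matrices `E_{i i₀} ⊗ E_{p p₀}`,
  -- which are pure tensors.
  have hent : ∀ a c i p, V (a, c) (i, p) =
      φ (single i i₀ 1 ⊗ₖ single p p₀ 1) (a, c) (v₁, v₂) / star (V (v₁, v₂) (i₀, p₀)) := by
    intro a c i p
    rw [eq_div_iff hv', single_kronecker_single, mul_one, hφ,
      mul_single_mul_conjTranspose_apply]
  have h1 := forall_left_or_forall_right
    (φ ∘ₗ (kroneckerBilinear (R := ℂ) (α := ℂ) (l := m) (m := m) (n := n) (p := n)).flip 1)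
    (fun A => hN _ (kronecker_one_mem_localSubspace A)) fun A => by
      change φ (A ⊗ₖ 1) * φ (A ⊗ₖ 1) = φ ((A * A) ⊗ₖ 1)
      rw [hmul, ← mul_kronecker_mul, Matrix.one_mul]
  have h2 := forall_left_or_forall_right
    (φ ∘ₗ kroneckerBilinear (R := ℂ) (α := ℂ) (l := m) (m := m) (n := n) (p := n) 1)
    (fun B => hN _ (one_kronecker_mem_localSubspace B)) fun B => by
      change φ (1 ⊗ₖ B) * φ (1 ⊗ₖ B) = φ (1 ⊗ₖ (B * B))
      rw [hmul, ← mul_kronecker_mul, Matrix.one_mul]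
  -- If both factors were mapped into the same factor, then so would be the whole algebra.
  have hLL : ¬ ((∀ A : Matrix m m ℂ, ∃ A' : Matrix m m ℂ, φ (A ⊗ₖ 1) = A' ⊗ₖ 1) ∧
      ∀ B : Matrix n n ℂ, ∃ A' : Matrix m m ℂ, φ (1 ⊗ₖ B) = A' ⊗ₖ 1) := by
    rintro ⟨hA, hB⟩
    let S : Submodule ℂ (Matrix (m × n) (m × n) ℂ) :=
      (LinearMap.range ((kroneckerBilinear (R := ℂ) (α := ℂ) (l := m) (m := m)
        (n := n) (p := n)).flip 1)).comap φ
    have hS : S = ⊤ := by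
      refine eq_top_of_forall_kronecker_mem fun A B => ?_
      obtain ⟨A', hA'⟩ := hA A
      obtain ⟨B', hB'⟩ := hB B
      refine ⟨A' * B', ?_⟩
      rw [hten, hA', hB', ← mul_kronecker_mul, Matrix.one_mul]
      rfl
    have hmem : Vᴴ * (1 ⊗ₖ single p₀ p₁ 1) * V ∈ S := hS ▸ trivial
    obtain ⟨A, hA⟩ := hmem
    rw [hsurj] at hA
    have : (A ⊗ₖ (1 : Matrix n n ℂ)) (i₀, p₀) (i₀, p₁) =
      ((1 : Matrix m m ℂ) ⊗ₖ single p₀ p₁ 1) (i₀, p₀) (i₀, p₁) := congrFun (congrFun hA _) _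
    simp [kroneckerMap_apply, hp] at this
  have hRR : ¬ ((∀ A : Matrix m m ℂ, ∃ B' : Matrix n n ℂ, φ (A ⊗ₖ 1) = 1 ⊗ₖ B') ∧
      ∀ B : Matrix n n ℂ, ∃ B' : Matrix n n ℂ, φ (1 ⊗ₖ B) = 1 ⊗ₖ B') := by
    rintro ⟨hA, hB⟩
    let S : Submodule ℂ (Matrix (m × n) (m × n) ℂ) :=
      (LinearMap.range (kroneckerBilinear (R := ℂ) (α := ℂ) (l := m) (m := m)
        (n := n) (p := n) 1)).comap φ
    have hS : S = ⊤ := by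
      refine eq_top_of_forall_kronecker_mem fun A B => ?_
      obtain ⟨A', hA'⟩ := hA A
      obtain ⟨B', hB'⟩ := hB B
      refine ⟨A' * B', ?_⟩
      rw [hten, hA', hB', ← mul_kronecker_mul, Matrix.one_mul]
      rfl
    have hmem : Vᴴ * (single i₀ i₁ 1 ⊗ₖ 1) * V ∈ S := hS ▸ trivial
    obtain ⟨B, hB⟩ := hmem
    rw [hsurj] at hB
    have : ((1 : Matrix m m ℂ) ⊗ₖ B) (i₀, p₀) (i₁, p₀) =
      (single i₀ i₁ 1 ⊗ₖ (1 : Matrix n n ℂ)) (i₀, p₀) (i₁, p₀) := congrFun (congrFun hB _) _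
    simp [kroneckerMap_apply, hi] at this
  rcases h1 with h1 | h1 <;> rcases h2 with h2 | h2
  · exact absurd ⟨h1, h2⟩ hLL
  · left
    choose α hα using h1
    choose β hβ using h2
    change ∀ A, φ (A ⊗ₖ 1) = α A ⊗ₖ 1 at hα
    change ∀ B, φ (1 ⊗ₖ B) = 1 ⊗ₖ β B at hβ
    refine ⟨of fun a i => α (single i i₀ 1) a v₁ / star (V (v₁, v₂) (i₀, p₀)),
      of fun c p => β (single p p₀ 1) c v₂, ?_⟩
    ext ⟨a, c⟩ ⟨i, p⟩
    rw [hent, hten, hα, hβ, ← mul_kronecker_mul, Matrix.one_mul, Matrix.mul_one]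
    simp only [kroneckerMap_apply, of_apply]
    ring
  · right
    choose β hβ using h1
    choose α hα using h2
    change ∀ B, φ (1 ⊗ₖ B) = α B ⊗ₖ 1 at hα
    change ∀ A, φ (A ⊗ₖ 1) = 1 ⊗ₖ β A at hβ
    refine ⟨of fun a p => α (single p p₀ 1) a v₁ / star (V (v₁, v₂) (i₀, p₀)),
      of fun c i => β (single i i₀ 1) c v₂, ?_⟩
    ext ⟨a, c⟩ ⟨p, i⟩
    rw [submatrix_apply, id, Prod.swap_prod_mk,
      hent, hten, hα, hβ, ← mul_kronecker_mul, Matrix.one_mul, Matrix.mul_one]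
    simp only [kroneckerMap_apply, of_apply]
    ring
  · exact absurd ⟨h1, h2⟩ hRR

/-- If a tensor product of matrices is unitary, its factors can be rescaled to unitaries. -/
theorem isLocalProduct_of_kronecker_mem_unitaryGroup [Nonempty m] [Nonempty n]
    {M : Matrix m m ℂ} {N : Matrix n n ℂ} (h : M ⊗ₖ N ∈ unitaryGroup (m × n) ℂ) :
    IsLocalProduct (M ⊗ₖ N) := by
  have h' := mem_unitaryGroup_iff.1 h
  rw [star_eq_conjTranspose, conjTranspose_kronecker, ← mul_kronecker_mul] at h'
  obtain ⟨c, hc, hM, hN⟩ := exists_smul_one_of_kronecker_eq_one h'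
  obtain ⟨a⟩ := ‹Nonempty m›
  obtain ⟨r, hr, rfl⟩ : ∃ r : ℝ, 0 < r ∧ c = ((r : ℝ) : ℂ) := by
    have hca : c = ((∑ i, ‖M a i‖ ^ 2 : ℝ) : ℂ) := by
      have := congrFun (congrFun hM a) a
      rw [Matrix.smul_apply, one_apply_eq, smul_eq_mul, mul_one] at this
      rw [← this]
      simp [mul_apply, Complex.mul_conj']
    refine ⟨_, lt_of_le_of_ne (Finset.sum_nonneg fun i _ => by positivity) ?_, hca⟩
    rintro h0
    rw [← h0] at hca
    exact hc (by simpa using hca)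
  have hs : ((√r : ℝ) : ℂ) * ((√r : ℝ) : ℂ) = r := by
    rw [← Complex.ofReal_mul, Real.mul_self_sqrt hr.le]
  have hs0 : ((√r : ℝ) : ℂ) ≠ 0 := by
    simpa using (Real.sqrt_pos.2 hr).ne'
  refine ⟨((√r : ℝ) : ℂ)⁻¹ • M, ?_, ((√r : ℝ) : ℂ) • N, ?_, ?_⟩
  · rw [mem_unitaryGroup_iff, star_smul, Matrix.mul_smul, Matrix.smul_mul, star_eq_conjTranspose,
      hM, smul_smul, smul_smul, ← hs]
    convert one_smul ℂ (1 : Matrix m m ℂ) using 2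
    simp
    field_simp
  · rw [mem_unitaryGroup_iff, star_smul, Matrix.mul_smul, Matrix.smul_mul, star_eq_conjTranspose,
      hN, smul_smul, smul_smul, ← hs]
    convert one_smul ℂ (1 : Matrix n n ℂ) using 2
    simp
    field_simp
  · rw [smul_kronecker, kronecker_smul, smul_smul, inv_mul_cancel₀ hs0, one_smul]

theorem mul_swapMatrix_apply (X : Matrix (n × n) (n × n) ℂ) (u y : n × n) :
    (X * swapMatrix n) u y = X u y.swap := by
  simp [mul_apply, swapMatrix]

theorem swapMatrix_mul_apply (X : Matrix (n × n) (n × n) ℂ) (u y : n × n) :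
    (swapMatrix n * X) u y = X u.swap y := by
  have : ∀ j : n × n, (u = j.swap) ↔ (u.swap = j) := fun j =>
    ⟨fun h => by rw [h, Prod.swap_swap], fun h => by rw [← h, Prod.swap_swap]⟩
  simp [mul_apply, swapMatrix, this]

theorem swapMatrix_mul_self : swapMatrix n * swapMatrix n = 1 := by
  ext u y
  rw [mul_swapMatrix_apply]
  simp [swapMatrix, one_apply]

theorem conjTranspose_swapMatrix {n : Type*} [DecidableEq n] : (swapMatrix n)ᴴ = swapMatrix n := by
  ext u y
  have : y = u.swap ↔ u = y.swap :=
    ⟨fun h => by rw [h, Prod.swap_swap], fun h => by rw [h, Prod.swap_swap]⟩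
  simp [swapMatrix, this, apply_ite]

theorem swapMatrix_mem_unitaryGroup : swapMatrix n ∈ unitaryGroup (n × n) ℂ := by
  rw [mem_unitaryGroup_iff, star_eq_conjTranspose, conjTranspose_swapMatrix, swapMatrix_mul_self]

/-- A unitary that normalizes the local operators on two systems of different dimension is a
local product: an exchange of the factors would force the dimensions to agree. -/
theorem isLocalProduct_of_normalizes [Nontrivial m] [Nontrivial n]
    (hcard : Fintype.card m ≠ Fintype.card n)
    {V : Matrix (m × n) (m × n) ℂ} (hV : V ∈ unitaryGroup (m × n) ℂ)
    (hN : ∀ X ∈ localSubspace m n, V * X * Vᴴ ∈ localSubspace m n) : IsLocalProduct V := by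
  rcases tensor_or_swap_of_normalizes hV hN with ⟨M, N, rfl⟩ | ⟨M, N, h⟩
  · exact isLocalProduct_of_kronecker_mem_unitaryGroup hV
  · exfalso
    -- `M Mᴴ` and `N Nᴴ` are non-zero scalars, so the rank bounds both dimensions by each other.
    have h1 : M ⊗ₖ N * (M ⊗ₖ N)ᴴ = 1 := by
      rw [← h, conjTranspose_submatrix]
      have := submatrix_mul_equiv V Vᴴ id (Equiv.prodComm n m) id
      rw [show (Prod.swap : n × m → m × n) = Equiv.prodComm n m from rfl, this,
        show V * Vᴴ = 1 from mem_unitaryGroup_iff.1 hV, submatrix_id_id]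
    rw [conjTranspose_kronecker, ← mul_kronecker_mul] at h1
    obtain ⟨c, hc, hM, hN⟩ := exists_smul_one_of_kronecker_eq_one h1
    exact hcard (le_antisymm (card_le_of_mul_conjTranspose_eq_smul_one hc hM)
      (card_le_of_mul_conjTranspose_eq_smul_one (inv_ne_zero hc) hN))

theorem isLocalProduct_or_isLocalProductSwap_of_normalizes [Nontrivial n]
    {V : Matrix (n × n) (n × n) ℂ} (hV : V ∈ unitaryGroup (n × n) ℂ)
    (hN : ∀ X ∈ localSubspace n n, V * X * Vᴴ ∈ localSubspace n n) :
    IsLocalProduct V ∨ IsLocalProductSwap V := by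
  rcases tensor_or_swap_of_normalizes hV hN with ⟨M, N, rfl⟩ | ⟨M, N, h⟩
  · exact Or.inl (isLocalProduct_of_kronecker_mem_unitaryGroup hV)
  · right
    have h1 : M ⊗ₖ N = V * swapMatrix n := by
      rw [← h]
      ext u y
      rw [mul_swapMatrix_apply, submatrix_apply, id]
    have h2 : M ⊗ₖ N ∈ unitaryGroup (n × n) ℂ :=
      h1 ▸ mul_mem hV swapMatrix_mem_unitaryGroup
    obtain ⟨U₁, hU₁, U₂, hU₂, hU⟩ := isLocalProduct_of_kronecker_mem_unitaryGroup h2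
    refine ⟨U₁, hU₁, U₂, hU₂, ?_⟩
    rw [← hU, h1, Matrix.mul_assoc, swapMatrix_mul_self, Matrix.mul_one]

end Normalizer

/-! ### Surjectivity of the exponential onto the special unitary group -/

section Exponential

open Matrix NormedSpace

variable {n : Type*} [Fintype n] [DecidableEq n]

/-- Jacobi's formula for skew-Hermitian matrices. -/
theorem det_exp_of_conjTranspose_eq_neg {X : Matrix n n ℂ} (hX : Xᴴ = -X) :
    (exp X).det = Complex.exp X.trace := by
  have hH : ((-Complex.I) • X).IsHermitian := by
    rw [IsHermitian, conjTranspose_smul, hX]; simp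
  set H := (-Complex.I) • X with hHdef
  have hXH : X = Complex.I • H := by
    rw [hHdef, smul_smul]; simp
  set P : Matrix n n ℂ := hH.eigenvectorUnitary.1 with hP
  have hPu : Pᴴ * P = 1 := mem_unitaryGroup_iff'.1 hH.eigenvectorUnitary.2
  have hPinv : P⁻¹ = Pᴴ := inv_eq_left_inv hPu
  have hspec : X = P * diagonal (fun i => Complex.I * (hH.eigenvalues i : ℂ)) * P⁻¹ := by
    have h := hH.spectral_theorem
    rw [Unitary.conjStarAlgAut_apply] at h
    have hd : diagonal (fun i => Complex.I * (hH.eigenvalues i : ℂ)) =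
        Complex.I • diagonal (RCLike.ofReal ∘ hH.eigenvalues : n → ℂ) := by
      rw [← diagonal_smul]; rfl
    rw [hd, hPinv, Matrix.mul_smul, Matrix.smul_mul, hXH]
    exact congrArg _ h
  have hunit : IsUnit P := IsUnit.of_mul_eq_one_right _ hPu
  have htr : X.trace = ∑ i, Complex.I * (hH.eigenvalues i : ℂ) := by
    conv_lhs => rw [hspec]
    rw [trace_mul_comm, ← Matrix.mul_assoc, hPinv, hPu, Matrix.one_mul, trace_diagonal]
  conv_lhs => rw [hspec]
  rw [exp_conj _ _ hunit, exp_diagonal, det_conj hunit, det_diagonal, htr, Complex.exp_sum]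
  refine Finset.prod_congr rfl fun i _ => ?_
  rw [Pi.coe_exp, Complex.exp_eq_exp_ℂ]

/-- Every unitary matrix has a skew-Hermitian logarithm: apply the discontinuous function
`z ↦ i arg z`, which is no obstacle since the spectrum is finite. -/
theorem exists_exp_eq_of_mem_unitaryGroup {U : Matrix n n ℂ} (hU : U ∈ unitaryGroup n ℂ) :
    ∃ X : Matrix n n ℂ, Xᴴ = -X ∧ exp X = U := by
  open scoped Matrix.Norms.L2Operator in
  have hcont : ∀ (M : Matrix n n ℂ) (f : ℂ → ℂ), ContinuousOn f (spectrum ℂ M) := fun M f =>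
    (Matrix.finite_spectrum M).continuousOn f
  have hN : IsStarNormal U := ⟨by
    rw [commute_iff_eq, (Unitary.mem_iff.1 hU).1, (Unitary.mem_iff.1 hU).2]⟩
  refine ⟨cfc (fun z : ℂ => Complex.I * (z.arg : ℂ)) U, ?_, ?_⟩
  · rw [← star_eq_conjTranspose, ← cfc_star, ← cfc_neg]
    refine cfc_congr fun z _ => ?_
    simp
  · rw [← CFC.exp_eq_normedSpace_exp (𝕜 := ℂ), ← cfc_comp' _ _ U
      (((Matrix.finite_spectrum U).image _).continuousOn _) (hcont _ _)]
    conv_rhs => rw [← cfc_id' ℂ U]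
    refine cfc_congr fun z hz => ?_
    have hz1 : ‖z‖ = 1 := spectrum.norm_eq_one_of_unitary hU hz
    have h := Complex.norm_mul_exp_arg_mul_I z
    rw [hz1, Complex.ofReal_one, one_mul, mul_comm] at h
    simpa [← Complex.exp_eq_exp_ℂ] using h

/-- Every matrix in `SU(n)` is a product of exponentials of two elements of `𝔰𝔲(n)`. A
skew-Hermitian logarithm has trace `2πik`; removing the trace changes the exponential by a scalar
`n`-th root of unity, which is the exponential of a traceless diagonal matrix. -/
theorem exists_exp_mul_exp_eq [Nonempty n] {U : Matrix n n ℂ}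
    (hU : U ∈ specialUnitaryGroup n ℂ) :
    ∃ X Y : Matrix n n ℂ, (Xᴴ = -X ∧ X.trace = 0) ∧ (Yᴴ = -Y ∧ Y.trace = 0) ∧
      exp X * exp Y = U := by
  obtain ⟨hU1, hU2⟩ := mem_specialUnitaryGroup_iff.1 hU
  obtain ⟨X, hX, rfl⟩ := exists_exp_eq_of_mem_unitaryGroup hU1
  rw [det_exp_of_conjTranspose_eq_neg hX] at hU2
  obtain ⟨a⟩ := ‹Nonempty n›
  set N : ℂ := (Fintype.card n : ℂ) with hN
  have hN0 : N ≠ 0 := by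
    have : Nonempty n := ⟨a⟩
    rw [hN]; exact_mod_cast Fintype.card_ne_zero
  have htr : star X.trace = -X.trace := by rw [← trace_conjTranspose, hX, trace_neg]
  set t := X.trace with ht
  set s := t / N with hs
  have hstar : star s = -s := by
    rw [hs, star_div₀, htr, hN, star_natCast, neg_div]
  let d : n → ℂ := fun i => if i = a then s - t else s
  have hexpd : exp (diagonal d) = exp (diagonal fun _ => s) := by
    rw [exp_diagonal, exp_diagonal]
    congr 1
    ext i
    rw [Pi.coe_exp, Pi.coe_exp, ← Complex.exp_eq_exp_ℂ]
    by_cases hi : i = a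
    · simp [d, hi, Complex.exp_sub, hU2]
    · simp [d, hi]
  have hscal : (diagonal fun _ : n => s) = s • (1 : Matrix n n ℂ) := by
    rw [smul_one_eq_diagonal]
  refine ⟨X - s • 1, diagonal d, ⟨?_, ?_⟩, ⟨?_, ?_⟩, ?_⟩
  · rw [conjTranspose_sub, conjTranspose_smul, hX, conjTranspose_one, hstar, neg_smul]; abel
  · rw [trace_sub, trace_smul, trace_one, ← hN, ← ht, hs, smul_eq_mul, div_mul_cancel₀ _ hN0,
      sub_self]
  · rw [diagonal_conjTranspose, diagonal_neg]
    congr 1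
    ext i
    by_cases hi : i = a
    · simp only [d, hi, Pi.star_apply, if_true, star_sub, hstar, htr]; ring
    · simp only [d, hi, Pi.star_apply, if_false, hstar]
  · have hd : d = fun i => s - if i = a then t else 0 := by
      ext i; by_cases hi : i = a <;> simp [d, hi]
    rw [trace_diagonal, hd, Finset.sum_sub_distrib, Finset.sum_ite_eq', if_pos (Finset.mem_univ a),
      Finset.sum_const, Finset.card_univ, nsmul_eq_mul, ← hN, hs, mul_div_cancel₀ _ hN0, sub_self]
  · have hcomm : Commute (X - s • 1) (s • (1 : Matrix n n ℂ)) :=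
      (Commute.one_right _).smul_right s
    rw [hexpd, hscal, ← Matrix.exp_add_of_commute _ _ hcomm, sub_add_cancel]

end Exponential

/-! ### Complexification of a real Lie algebra -/

section Complexification

open Matrix

variable {n : Type*}

/-- The complexification `g + ig` of a real space `g` of skew-Hermitian matrices, described by the
skew-Hermitian and Hermitian parts of its elements. -/
def complexification (g : Submodule ℝ (Matrix n n ℂ)) : Submodule ℂ (Matrix n n ℂ) where
  carrier := {X | X - Xᴴ ∈ g ∧ Complex.I • (X + Xᴴ) ∈ g}
  zero_mem' := by simp
  add_mem' := by
    rintro X Y ⟨hX, hX'⟩ ⟨hY, hY'⟩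
    refine ⟨?_, ?_⟩
    · convert g.add_mem hX hY using 1
      rw [conjTranspose_add]; abel
    · convert g.add_mem hX' hY' using 1
      rw [conjTranspose_add, ← smul_add]; congr 1; abel
  smul_mem' := by
    rintro c X ⟨hX, hX'⟩
    refine ⟨?_, ?_⟩
    · convert g.add_mem (g.smul_mem c.re hX) (g.smul_mem c.im hX') using 1
      ext i j
      apply Complex.ext <;> simp <;> ring
    · convert g.sub_mem (g.smul_mem c.re hX') (g.smul_mem c.im hX) using 1
      ext i j
      apply Complex.ext <;> simp <;> ring

theorem mem_complexification {g : Submodule ℝ (Matrix n n ℂ)} {X : Matrix n n ℂ} :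
    X ∈ complexification g ↔ X - Xᴴ ∈ g ∧ Complex.I • (X + Xᴴ) ∈ g := Iff.rfl

theorem mem_complexification_iff_of_conjTranspose_eq_neg {g : Submodule ℝ (Matrix n n ℂ)}
    {X : Matrix n n ℂ} (hX : Xᴴ = -X) : X ∈ complexification g ↔ X ∈ g := by
  rw [mem_complexification, hX, sub_neg_eq_add, add_neg_cancel, smul_zero, ← two_smul ℝ,
    g.smul_mem_iff (by norm_num)]
  simp

theorem exists_eq_add_I_smul_of_mem_complexification {g : Submodule ℝ (Matrix n n ℂ)}
    {X : Matrix n n ℂ} (hX : X ∈ complexification g) :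
    ∃ A ∈ g, ∃ B ∈ g, X = A + Complex.I • B := by
  refine ⟨(1 / 2 : ℝ) • (X - Xᴴ), g.smul_mem _ hX.1,
    (-1 / 2 : ℝ) • Complex.I • (X + Xᴴ), g.smul_mem _ hX.2, ?_⟩
  ext i j
  apply Complex.ext <;> simp <;> ring

theorem commutator_mem_complexification [Fintype n] {g : Submodule ℝ (Matrix n n ℂ)}
    (hskew : ∀ X ∈ g, Xᴴ = -X) (hlie : ∀ X ∈ g, ∀ Y ∈ g, X * Y - Y * X ∈ g)
    {X Y : Matrix n n ℂ} (hX : X ∈ complexification g) (hY : Y ∈ complexification g) :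
    X * Y - Y * X ∈ complexification g := by
  have key : ∀ A ∈ g, A * Y - Y * A ∈ complexification g := by
    intro A hA
    have hc : (A * Y - Y * A)ᴴ = A * Yᴴ - Yᴴ * A := by
      rw [conjTranspose_sub, conjTranspose_mul, conjTranspose_mul, hskew A hA]
      noncomm_ring
    refine ⟨?_, ?_⟩
    · convert hlie A hA _ hY.1 using 1
      rw [hc]; noncomm_ring
    · convert hlie A hA _ hY.2 using 1
      rw [hc, Matrix.mul_smul, Matrix.smul_mul, ← smul_sub]; congr 1; noncomm_ring
  obtain ⟨A, hA, B, hB, rfl⟩ := exists_eq_add_I_smul_of_mem_complexification hX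
  convert (complexification g).add_mem (key A hA)
    ((complexification g).smul_mem Complex.I (key B hB)) using 1
  rw [add_mul, mul_add, Matrix.smul_mul, Matrix.mul_smul, smul_sub]
  abel

theorem conj_mem_complexification [Fintype n] {g : Submodule ℝ (Matrix n n ℂ)} {V : Matrix n n ℂ}
    (hV : ∀ X ∈ g, V * X * Vᴴ ∈ g) {X : Matrix n n ℂ} (hX : X ∈ complexification g) :
    V * X * Vᴴ ∈ complexification g := by
  have hc : (V * X * Vᴴ)ᴴ = V * Xᴴ * Vᴴ := by
    simp [conjTranspose_mul, Matrix.mul_assoc]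
  refine ⟨?_, ?_⟩
  · convert hV _ hX.1 using 1
    rw [hc, mul_sub, sub_mul]
  · convert hV _ hX.2 using 1
    rw [hc, Matrix.mul_smul, Matrix.smul_mul, mul_add, add_mul]

theorem trace_eq_zero_of_mem_complexification [Fintype n] {g : Submodule ℝ (Matrix n n ℂ)}
    (htr : ∀ X ∈ g, X.trace = 0) {X : Matrix n n ℂ} (hX : X ∈ complexification g) :
    X.trace = 0 := by
  obtain ⟨A, hA, B, hB, rfl⟩ := exists_eq_add_I_smul_of_mem_complexification hX
  simp [htr A hA, htr B hB]

/-- If the complexification of `g ≤ 𝔰𝔲(n)` and the scalars span all matrices, then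
`g = 𝔰𝔲(n)`. -/
theorem mem_of_complexification_sup_eq_top [Fintype n] [DecidableEq n] [Nonempty n]
    {g : Submodule ℝ (Matrix n n ℂ)} (htr : ∀ X ∈ g, X.trace = 0)
    (htop : complexification g ⊔ Submodule.span ℂ {1} = ⊤) {X : Matrix n n ℂ}
    (hX : Xᴴ = -X) (hX0 : X.trace = 0) : X ∈ g := by
  have hmem : X ∈ complexification g ⊔ Submodule.span ℂ {1} := htop ▸ Submodule.mem_top
  obtain ⟨Y, hY, Z, hZ, rfl⟩ := Submodule.mem_sup.1 hmem
  obtain ⟨c, rfl⟩ := Submodule.mem_span_singleton.1 hZ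
  have hc : c = 0 := by
    rw [trace_add, trace_eq_zero_of_mem_complexification htr hY, trace_smul, trace_one,
      zero_add, smul_eq_mul, mul_eq_zero] at hX0
    exact hX0.resolve_right (by exact_mod_cast Fintype.card_ne_zero)
  rw [hc, zero_smul, add_zero] at hX ⊢
  exact (mem_complexification_iff_of_conjTranspose_eq_neg hX).1 hY

end Complexification

/-! ### Closed subgroups containing the local gates -/

section Group

open Matrix NormedSpace

variable {m n : Type*} [Fintype m] [DecidableEq m] [Fintype n] [DecidableEq n]

instance specialUnitaryGroup.instIsTopologicalGroup :
    IsTopologicalGroup (specialUnitaryGroup n ℂ) where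
  continuous_inv := continuous_induced_rng.2 (continuous_star.comp continuous_subtype_val)

theorem isClosed_specialUnitaryGroup :
    IsClosed (specialUnitaryGroup n ℂ : Set (Matrix n n ℂ)) := by
  have h : (specialUnitaryGroup n ℂ : Set (Matrix n n ℂ)) =
      (unitary (Matrix n n ℂ) : Set (Matrix n n ℂ)) ∩ {A | A.det = 1} := by
    ext A
    exact mem_specialUnitaryGroup_iff
  rw [h]
  exact isClosed_unitary.inter (isClosed_eq (continuous_id.matrix_det) continuous_const)

/-- The matrices of the elements of a subgroup of `SU(n)`. -/
def matrixSubmonoid (G : Subgroup (specialUnitaryGroup n ℂ)) : Submonoid (Matrix n n ℂ) :=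
  G.toSubmonoid.map (specialUnitaryGroup n ℂ).subtype

theorem coe_mem_matrixSubmonoid {G : Subgroup (specialUnitaryGroup n ℂ)}
    {U : specialUnitaryGroup n ℂ} : (U : Matrix n n ℂ) ∈ matrixSubmonoid G ↔ U ∈ G :=
  ⟨fun ⟨_, hU', h⟩ => Subtype.ext h ▸ hU', fun h => ⟨U, h, rfl⟩⟩

theorem isClosed_matrixSubmonoid {G : Subgroup (specialUnitaryGroup n ℂ)}
    (hG : IsClosed (G : Set (specialUnitaryGroup n ℂ))) :
    IsClosed (matrixSubmonoid G : Set (Matrix n n ℂ)) :=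
  isClosed_specialUnitaryGroup.isClosedEmbedding_subtypeVal.isClosedMap _ hG

theorem exp_mem_specialUnitaryGroup {X : Matrix n n ℂ} (hX : Xᴴ = -X) (hX0 : X.trace = 0) :
    exp X ∈ specialUnitaryGroup n ℂ :=
  mem_specialUnitaryGroup_iff.2 ⟨exp_mem_unitaryGroup hX, by
    rw [det_exp_of_conjTranspose_eq_neg hX, hX0, Complex.exp_zero]⟩

theorem exp_kronecker_one (X : Matrix m m ℂ) :
    exp (X ⊗ₖ (1 : Matrix n n ℂ)) = exp X ⊗ₖ 1 := by
  open scoped Matrix.Norms.L2Operator in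
  let f : Matrix m m ℂ →+* Matrix (m × n) (m × n) ℂ :=
    { toFun := fun A => A ⊗ₖ 1
      map_one' := one_kronecker_one
      map_mul' := fun A B => by rw [← mul_kronecker_mul, Matrix.one_mul]
      map_zero' := zero_kronecker _
      map_add' := fun A B => add_kronecker _ _ _ }
  have hf : Continuous f := continuous_matrix fun i j =>
    (continuous_id.matrix_elem i.1 j.1).mul continuous_const
  let _ : NormedAlgebra ℚ (Matrix m m ℂ) := NormedAlgebra.restrictScalars ℚ ℂ _
  exact (map_exp f hf X).symm

theorem exp_one_kronecker (X : Matrix n n ℂ) :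
    exp ((1 : Matrix m m ℂ) ⊗ₖ X) = 1 ⊗ₖ exp X := by
  open scoped Matrix.Norms.L2Operator in
  let f : Matrix n n ℂ →+* Matrix (m × n) (m × n) ℂ :=
    { toFun := fun A => 1 ⊗ₖ A
      map_one' := one_kronecker_one
      map_mul' := fun A B => by rw [← mul_kronecker_mul, Matrix.one_mul]
      map_zero' := kronecker_zero _
      map_add' := fun A B => kronecker_add _ _ _ }
  have hf : Continuous f := continuous_matrix fun i j =>
    continuous_const.mul (continuous_id.matrix_elem i.2 j.2)
  let _ : NormedAlgebra ℚ (Matrix n n ℂ) := NormedAlgebra.restrictScalars ℚ ℂ _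
  exact (map_exp f hf X).symm

theorem kronecker_one_mem_lieSubspace [Nonempty m] [Nonempty n]
    {G : Subgroup (specialUnitaryGroup (m × n) ℂ)}
    (hG : IsClosed (G : Set (specialUnitaryGroup (m × n) ℂ)))
    (hGm : ∀ A : specialUnitaryGroup m ℂ, tensorSU A 1 ∈ G) {X : Matrix m m ℂ} (hX : Xᴴ = -X)
    (hX0 : X.trace = 0) :
    X ⊗ₖ (1 : Matrix n n ℂ) ∈ lieSubspace (matrixSubmonoid G) (isClosed_matrixSubmonoid hG) := by
  refine ⟨?_, ?_, fun t => ?_⟩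
  · rw [conjTranspose_kronecker, hX, conjTranspose_one]
    ext; simp [kroneckerMap_apply]
  · rw [trace_kronecker, hX0, zero_mul]
  · have ht0 : (t • X).trace = 0 := by rw [trace_smul, hX0, smul_zero]
    rw [← smul_kronecker, exp_kronecker_one]
    exact coe_mem_matrixSubmonoid.2 (hGm
      ⟨_, exp_mem_specialUnitaryGroup (conjTranspose_real_smul_eq_neg hX t) ht0⟩)

theorem one_kronecker_mem_lieSubspace [Nonempty m] [Nonempty n]
    {G : Subgroup (specialUnitaryGroup (m × n) ℂ)}
    (hG : IsClosed (G : Set (specialUnitaryGroup (m × n) ℂ)))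
    (hGn : ∀ B : specialUnitaryGroup n ℂ, tensorSU 1 B ∈ G) {X : Matrix n n ℂ} (hX : Xᴴ = -X)
    (hX0 : X.trace = 0) :
    (1 : Matrix m m ℂ) ⊗ₖ X ∈ lieSubspace (matrixSubmonoid G) (isClosed_matrixSubmonoid hG) := by
  refine ⟨?_, ?_, fun t => ?_⟩
  · rw [conjTranspose_kronecker, hX, conjTranspose_one]
    ext; simp [kroneckerMap_apply]
  · rw [trace_kronecker, hX0, mul_zero]
  · have ht0 : (t • X).trace = 0 := by rw [trace_smul, hX0, smul_zero]
    rw [← kronecker_smul, exp_one_kronecker]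
    exact coe_mem_matrixSubmonoid.2 (hGn
      ⟨_, exp_mem_specialUnitaryGroup (conjTranspose_real_smul_eq_neg hX t) ht0⟩)

/-- Every square matrix is the sum of a scalar and of a traceless matrix. -/
theorem exists_eq_add_smul_one_of_trace_eq_zero [Nonempty m] (A : Matrix m m ℂ) :
    ∃ (A₀ : Matrix m m ℂ) (c : ℂ), A₀.trace = 0 ∧ A = A₀ + c • 1 := by
  have hm : (Fintype.card m : ℂ) ≠ 0 := by exact_mod_cast Fintype.card_ne_zero
  refine ⟨A - (A.trace / Fintype.card m) • 1, A.trace / Fintype.card m, ?_, by simp⟩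
  rw [trace_sub, trace_smul, trace_one, smul_eq_mul, div_mul_cancel₀ _ hm, sub_self]

/-- A closed subgroup of `SU(mn)` that contains `SU(m) ⊗ I` and `I ⊗ SU(n)` and an element which
does not normalize the local operators is the whole group. -/
theorem eq_top_of_not_normalizes [Nonempty m] [Nonempty n]
    {G : Subgroup (specialUnitaryGroup (m × n) ℂ)}
    (hG : IsClosed (G : Set (specialUnitaryGroup (m × n) ℂ)))
    (hGm : ∀ A : specialUnitaryGroup m ℂ, tensorSU A 1 ∈ G)
    (hGn : ∀ B : specialUnitaryGroup n ℂ, tensorSU 1 B ∈ G)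
    {V : specialUnitaryGroup (m × n) ℂ} (hV : V ∈ G)
    (hN : ¬ ∀ X ∈ localSubspace m n, V.1 * X * V.1ᴴ ∈ localSubspace m n) : G = ⊤ := by
  -- The scalars are added so that arbitrary matrices can be used instead of traceless ones.
  set g := lieSubspace (matrixSubmonoid G) (isClosed_matrixSubmonoid hG) with hg
  have htr : ∀ X ∈ g, X.trace = 0 := fun X hX => hX.2.1
  set W := complexification g ⊔ Submodule.span ℂ {1} with hWdef
  have hone : (1 : Matrix (m × n) (m × n) ℂ) ∈ W :=
    (le_sup_right : _ ≤ W) (Submodule.mem_span_singleton_self 1)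
  have hcW : ∀ X ∈ complexification g, X ∈ W := fun X hX => (le_sup_left : _ ≤ W) hX
  have hWdec : ∀ X ∈ W, ∃ Y ∈ complexification g, ∃ c : ℂ, X = Y + c • 1 := by
    intro X hX
    obtain ⟨Y, hY, Z, hZ, rfl⟩ := Submodule.mem_sup.1 hX
    obtain ⟨c, rfl⟩ := Submodule.mem_span_singleton.1 hZ
    exact ⟨Y, hY, c, rfl⟩
  have hbr : ∀ X ∈ W, ∀ Y ∈ W, X * Y - Y * X ∈ W := by
    intro X hX Y hY
    obtain ⟨X, hX', c, rfl⟩ := hWdec X hX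
    obtain ⟨Y, hY', d, rfl⟩ := hWdec Y hY
    have h : (X + c • 1) * (Y + d • 1) - (Y + d • 1) * (X + c • 1) = X * Y - Y * X := by
      simp only [add_mul, mul_add, Matrix.smul_mul, Matrix.mul_smul, Matrix.one_mul,
        Matrix.mul_one, smul_comm c d]
      abel
    rw [h]
    exact hcW _ (commutator_mem_complexification (g := g) (fun X hX => hX.1)
      (fun X hX Y hY => commutator_mem_lieSubspace hX hY) hX' hY')
  have hconj : ∀ X ∈ W, V.1 * X * V.1ᴴ ∈ W := by
    intro X hX
    obtain ⟨X, hX', c, rfl⟩ := hWdec X hX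
    have h : V.1 * (X + c • 1) * V.1ᴴ = V.1 * X * V.1ᴴ + c • 1 := by
      rw [mul_add, add_mul, Matrix.mul_smul, Matrix.smul_mul, Matrix.mul_one,
        show V.1 * V.1ᴴ = 1 from mem_unitaryGroup_iff.1 V.2.1]
    rw [h]
    refine W.add_mem (hcW _ (conj_mem_complexification (g := g) (fun Y hY => ?_) hX'))
      (W.smul_mem c hone)
    exact conj_mem_lieSubspace V.2.1 (coe_mem_matrixSubmonoid.2 hV)
      (coe_mem_matrixSubmonoid.2 (G.inv_mem hV)) hY
  have hleft : ∀ A : Matrix m m ℂ, A ⊗ₖ (1 : Matrix n n ℂ) ∈ W := by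
    intro A
    obtain ⟨A, c, hA, rfl⟩ := exists_eq_add_smul_one_of_trace_eq_zero A
    rw [add_kronecker, smul_kronecker, one_kronecker_one]
    refine W.add_mem (hcW _ (mem_complexification.2 ⟨?_, ?_⟩)) (W.smul_mem c hone)
    · convert kronecker_one_mem_lieSubspace hG hGm (X := A - Aᴴ) ?_ ?_ using 1
      · rw [conjTranspose_kronecker, conjTranspose_one]
        ext; simp [kroneckerMap_apply, sub_mul]
      · simp
      · simp [trace_conjTranspose, hA]
    · convert kronecker_one_mem_lieSubspace hG hGm (X := Complex.I • (A + Aᴴ)) ?_ ?_ using 1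
      · rw [smul_kronecker, add_kronecker, conjTranspose_kronecker, conjTranspose_one]
      · simp [add_comm]
      · simp [trace_conjTranspose, hA]
  have hright : ∀ B : Matrix n n ℂ, (1 : Matrix m m ℂ) ⊗ₖ B ∈ W := by
    intro B
    obtain ⟨B, c, hB, rfl⟩ := exists_eq_add_smul_one_of_trace_eq_zero B
    rw [kronecker_add, kronecker_smul, one_kronecker_one]
    refine W.add_mem (hcW _ (mem_complexification.2 ⟨?_, ?_⟩)) (W.smul_mem c hone)
    · convert one_kronecker_mem_lieSubspace hG hGn (X := B - Bᴴ) ?_ ?_ using 1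
      · rw [conjTranspose_kronecker, conjTranspose_one]
        ext; simp [kroneckerMap_apply, mul_sub]
      · simp
      · simp [trace_conjTranspose, hB]
    · convert one_kronecker_mem_lieSubspace hG hGn (X := Complex.I • (B + Bᴴ)) ?_ ?_ using 1
      · rw [kronecker_smul, kronecker_add, conjTranspose_kronecker, conjTranspose_one]
      · simp [add_comm]
      · simp [trace_conjTranspose, hB]
  have hloc : localSubspace m n ≤ W := by
    rintro _ ⟨A, B, rfl⟩
    exact W.add_mem (hleft A) (hright B)
  -- If `W` consisted of local operators, then `V` would normalize them, since `W` is stable under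
  -- conjugation by `V` and contains them.
  have htop : W = ⊤ := (le_localSubspace_or_eq_top hloc
    (fun A => hbr _ (hleft A)) fun B => hbr _ (hright B)).resolve_left
    fun hle => hN fun X hX => hle (hconj X (hloc hX))
  rw [Subgroup.eq_top_iff']
  intro U
  obtain ⟨X, Y, ⟨hX, hX0⟩, ⟨hY, hY0⟩, hXY⟩ := exists_exp_mul_exp_eq U.2
  have hexp : ∀ Z : Matrix (m × n) (m × n) ℂ, Zᴴ = -Z → Z.trace = 0 →
      exp Z ∈ matrixSubmonoid G := by
    intro Z hZ hZ0
    have h : Z ∈ g := mem_of_complexification_sup_eq_top htr htop hZ hZ0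
    simpa using h.2.2 1
  rw [← coe_mem_matrixSubmonoid, ← hXY]
  exact mul_mem (hexp X hX hX0) (hexp Y hY hY0)

theorem mem_of_dense_closure {G : Type*} [Group G] [TopologicalSpace G] {S : Set G}
    (hS : Dense (Subgroup.closure S : Set G)) {H : Subgroup G} (hH : IsClosed (H : Set G))
    (hSH : S ⊆ H) (x : G) : x ∈ H := by
  have h : closure (Subgroup.closure S : Set G) ⊆ H :=
    closure_minimal ((Subgroup.closure_le H).2 hSH) hH
  exact h (hS x)

theorem continuous_tensorSU :
    Continuous fun p : specialUnitaryGroup m ℂ × specialUnitaryGroup n ℂ => tensorSU p.1 p.2 :=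
  continuous_induced_rng.2 <| continuous_matrix fun i j =>
    ((continuous_subtype_val.comp continuous_fst).matrix_elem i.1 j.1).mul
      ((continuous_subtype_val.comp continuous_snd).matrix_elem i.2 j.2)

theorem tensorSU_mul_tensorSU (A A' : specialUnitaryGroup m ℂ) (B B' : specialUnitaryGroup n ℂ) :
    tensorSU A B * tensorSU A' B' = tensorSU (A * A') (B * B') :=
  Subtype.ext (mul_kronecker_mul _ _ _ _).symm

theorem tensorSU_one_one :
    tensorSU (1 : specialUnitaryGroup m ℂ) (1 : specialUnitaryGroup n ℂ) = 1 :=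
  Subtype.ext one_kronecker_one

theorem tensorSU_left_mem {S : Set (specialUnitaryGroup m ℂ)} (hS : IsUniversal S)
    {G : Subgroup (specialUnitaryGroup (m × n) ℂ)}
    (hG : IsClosed (G : Set (specialUnitaryGroup (m × n) ℂ))) (hSG : ∀ A ∈ S, tensorSU A 1 ∈ G)
    (A : specialUnitaryGroup m ℂ) : tensorSU A 1 ∈ G := by
  let f : specialUnitaryGroup m ℂ →* specialUnitaryGroup (m × n) ℂ :=
    { toFun := fun A => tensorSU A 1
      map_one' := tensorSU_one_one
      map_mul' := fun A B => by rw [tensorSU_mul_tensorSU, mul_one] }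
  have hf : Continuous f := continuous_tensorSU.comp (continuous_id.prodMk continuous_const)
  exact mem_of_dense_closure hS (H := G.comap f) (hG.preimage hf) hSG A

theorem tensorSU_right_mem {T : Set (specialUnitaryGroup n ℂ)} (hT : IsUniversal T)
    {G : Subgroup (specialUnitaryGroup (m × n) ℂ)}
    (hG : IsClosed (G : Set (specialUnitaryGroup (m × n) ℂ))) (hTG : ∀ B ∈ T, tensorSU 1 B ∈ G)
    (B : specialUnitaryGroup n ℂ) : tensorSU 1 B ∈ G := by
  let f : specialUnitaryGroup n ℂ →* specialUnitaryGroup (m × n) ℂ :=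
    { toFun := fun B => tensorSU 1 B
      map_one' := tensorSU_one_one
      map_mul' := fun A B => by rw [tensorSU_mul_tensorSU, mul_one] }
  have hf : Continuous f := continuous_tensorSU.comp (continuous_const.prodMk continuous_id)
  exact mem_of_dense_closure hT (H := G.comap f) (hG.preimage hf) hTG B

theorem isUniversal_compositeGates_of_not_normalizes [Nonempty m] [Nonempty n]
    {S : Set (specialUnitaryGroup m ℂ)} {T : Set (specialUnitaryGroup n ℂ)}
    (hS : IsUniversal S) (hT : IsUniversal T) {V : specialUnitaryGroup (m × n) ℂ}
    (hN : ¬ ∀ X ∈ localSubspace m n, V.1 * X * V.1ᴴ ∈ localSubspace m n) :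
    IsUniversal (compositeGates S T V) := by
  set G := (Subgroup.closure (compositeGates S T V)).topologicalClosure with hGdef
  have hG : IsClosed (G : Set (specialUnitaryGroup (m × n) ℂ)) :=
    Subgroup.isClosed_topologicalClosure _
  have hsub : ∀ U ∈ compositeGates S T V, U ∈ G := fun U hU =>
    Subgroup.le_topologicalClosure _ (Subgroup.subset_closure hU)
  have htop : G = ⊤ := eq_top_of_not_normalizes hG
    (tensorSU_left_mem hS hG fun A hA => hsub _ (Or.inl (Or.inl ⟨A, hA, rfl⟩)))
    (tensorSU_right_mem hT hG fun B hB => hsub _ (Or.inl (Or.inr ⟨B, hB, rfl⟩)))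
    (hsub V (Or.inr rfl)) hN
  intro U
  have hU : U ∈ G := htop ▸ Subgroup.mem_top U
  exact hU

end Group

/-! ### The normalizer of the local operators is a proper closed subgroup -/

section Converse

open Matrix

variable {m n : Type*} [Fintype m] [DecidableEq m] [Fintype n] [DecidableEq n]

/-- The subgroup of `SU(mn)` normalizing the local operators. -/
def localNormalizer (m n : Type*) [Fintype m] [DecidableEq m] [Fintype n] [DecidableEq n] :
    Subgroup (specialUnitaryGroup (m × n) ℂ) where
  carrier := {V | ∀ X ∈ localSubspace m n,
    V.1 * X * V.1ᴴ ∈ localSubspace m n ∧ V.1ᴴ * X * V.1 ∈ localSubspace m n}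
  one_mem' := fun X hX => by simpa using hX
  mul_mem' := by
    intro V W hV hW X hX
    have h1 : (V * W).1 * X * (V * W).1ᴴ = V.1 * (W.1 * X * W.1ᴴ) * V.1ᴴ := by
      simp [conjTranspose_mul, Matrix.mul_assoc]
    have h2 : (V * W).1ᴴ * X * (V * W).1 = W.1ᴴ * (V.1ᴴ * X * V.1) * W.1 := by
      simp [conjTranspose_mul, Matrix.mul_assoc]
    rw [h1, h2]
    exact ⟨(hV _ (hW X hX).1).1, (hW _ (hV X hX).2).2⟩
  inv_mem' := by
    intro V hV X hX
    have h : (V⁻¹).1 = V.1ᴴ := rfl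
    rw [h, conjTranspose_conjTranspose]
    exact (hV X hX).symm

theorem mem_localNormalizer {V : specialUnitaryGroup (m × n) ℂ} :
    V ∈ localNormalizer m n ↔ ∀ X ∈ localSubspace m n,
      V.1 * X * V.1ᴴ ∈ localSubspace m n ∧ V.1ᴴ * X * V.1 ∈ localSubspace m n := Iff.rfl

theorem isClosed_localNormalizer :
    IsClosed (localNormalizer m n : Set (specialUnitaryGroup (m × n) ℂ)) := by
  have hL : IsClosed (localSubspace m n : Set (Matrix (m × n) (m × n) ℂ)) :=
    Submodule.closed_of_finiteDimensional _
  have h : (localNormalizer m n : Set (specialUnitaryGroup (m × n) ℂ)) =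
      ⋂ X ∈ localSubspace m n, {V | V.1 * X * V.1ᴴ ∈ localSubspace m n ∧
        V.1ᴴ * X * V.1 ∈ localSubspace m n} := by
    ext V
    simp [mem_localNormalizer]
  rw [h]
  refine isClosed_biInter fun X _ => ?_
  have hc : Continuous fun V : specialUnitaryGroup (m × n) ℂ => V.1 := continuous_subtype_val
  exact (hL.preimage ((hc.mul continuous_const).mul hc.matrix_conjTranspose)).inter
    (hL.preimage ((hc.matrix_conjTranspose.mul continuous_const).mul hc))

theorem kronecker_conj_mem_localSubspace {U₁ : Matrix m m ℂ} {U₂ : Matrix n n ℂ}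
    (h₁ : U₁ ∈ unitaryGroup m ℂ) (h₂ : U₂ ∈ unitaryGroup n ℂ)
    {X : Matrix (m × n) (m × n) ℂ} (hX : X ∈ localSubspace m n) :
    (U₁ ⊗ₖ U₂) * X * (U₁ ⊗ₖ U₂)ᴴ ∈ localSubspace m n := by
  obtain ⟨A, B, rfl⟩ := hX
  refine ⟨U₁ * A * U₁ᴴ, U₂ * B * U₂ᴴ, ?_⟩
  have h1 : U₁ * U₁ᴴ = 1 := mem_unitaryGroup_iff.1 h₁
  have h2 : U₂ * U₂ᴴ = 1 := mem_unitaryGroup_iff.1 h₂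
  rw [mul_add, add_mul, conjTranspose_kronecker]
  simp only [← mul_kronecker_mul, Matrix.mul_one, h1, h2]

theorem swapMatrix_conj_mem_localSubspace {X : Matrix (n × n) (n × n) ℂ}
    (hX : X ∈ localSubspace n n) : swapMatrix n * X * swapMatrix n ∈ localSubspace n n := by
  obtain ⟨A, B, rfl⟩ := hX
  refine ⟨B, A, ?_⟩
  ext ⟨i, p⟩ ⟨j, q⟩
  rw [mul_swapMatrix_apply, swapMatrix_mul_apply]
  simp only [Prod.swap_prod_mk, Matrix.add_apply, kroneckerMap_apply]
  ring

theorem mem_localNormalizer_of_isLocalProduct {V : specialUnitaryGroup (m × n) ℂ}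
    (hV : IsLocalProduct V.1) : V ∈ localNormalizer m n := by
  obtain ⟨U₁, h₁, U₂, h₂, h⟩ := hV
  intro X hX
  rw [h]
  refine ⟨kronecker_conj_mem_localSubspace h₁ h₂ hX, ?_⟩
  have := kronecker_conj_mem_localSubspace (Unitary.star_mem h₁) (Unitary.star_mem h₂) hX
  rwa [star_eq_conjTranspose, star_eq_conjTranspose, ← conjTranspose_kronecker,
    conjTranspose_conjTranspose] at this

theorem mem_localNormalizer_of_isLocalProductSwap {V : specialUnitaryGroup (n × n) ℂ}
    (hV : IsLocalProductSwap V.1) : V ∈ localNormalizer n n := by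
  obtain ⟨U₁, h₁, U₂, h₂, h⟩ := hV
  intro X hX
  rw [h, conjTranspose_mul, conjTranspose_swapMatrix]
  constructor
  · have := kronecker_conj_mem_localSubspace h₁ h₂ (swapMatrix_conj_mem_localSubspace hX)
    simpa only [Matrix.mul_assoc] using this
  · have := swapMatrix_conj_mem_localSubspace
      (kronecker_conj_mem_localSubspace (Unitary.star_mem h₁) (Unitary.star_mem h₂) hX)
    rw [star_eq_conjTranspose, star_eq_conjTranspose, ← conjTranspose_kronecker,
      conjTranspose_conjTranspose] at this
    simpa only [Matrix.mul_assoc] using this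

/-- The diagonal matrix with entries `i`, `-i`, `1, …, 1` witnesses that not every element of
`SU(mn)` normalizes the local operators. -/
theorem localNormalizer_ne_top [Nontrivial m] [Nontrivial n] : localNormalizer m n ≠ ⊤ := by
  intro htop
  obtain ⟨i₀, i₁, hi⟩ := exists_pair_ne m
  obtain ⟨p₀, p₁, hp⟩ := exists_pair_ne n
  let d : m × n → ℂ := fun x =>
    (if x = (i₀, p₀) then Complex.I else 1) * (if x = (i₀, p₁) then -Complex.I else 1)
  have hd : diagonal d ∈ specialUnitaryGroup (m × n) ℂ := by
    rw [mem_specialUnitaryGroup_iff]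
    constructor
    · rw [mem_unitaryGroup_iff, star_eq_conjTranspose, diagonal_conjTranspose,
        diagonal_mul_diagonal, ← diagonal_one]
      congr 1
      ext x
      simp only [d, Pi.star_apply]
      split_ifs <;> simp
    · rw [det_diagonal, Finset.prod_mul_distrib, Finset.prod_ite_eq', Finset.prod_ite_eq']
      simp
  have hmem : (⟨_, hd⟩ : specialUnitaryGroup (m × n) ℂ) ∈ localNormalizer m n :=
    htop ▸ Subgroup.mem_top _
  obtain ⟨A, B, hAB⟩ := (hmem _ (kronecker_one_mem_localSubspace (single i₀ i₁ 1))).1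
  have hent : ∀ p, d (i₀, p) * star (d (i₁, p)) = A i₀ i₁ := by
    intro p
    have := congrFun (congrFun hAB (i₀, p)) (i₁, p)
    rw [diagonal_conjTranspose, mul_diagonal, diagonal_mul] at this
    simpa [kroneckerMap_apply, hi] using this
  have h := (hent p₀).trans (hent p₁).symm
  simp [d, hi.symm, hp, hp.symm] at h
  exact Complex.I_ne_zero (self_eq_neg.1 h)

theorem not_isUniversal_compositeGates [Nontrivial m] [Nontrivial n]
    {S : Set (specialUnitaryGroup m ℂ)} {T : Set (specialUnitaryGroup n ℂ)}
    {V : specialUnitaryGroup (m × n) ℂ} (hV : V ∈ localNormalizer m n) :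
    ¬ IsUniversal (compositeGates S T V) := by
  intro h
  refine localNormalizer_ne_top (m := m) (n := n) ((Subgroup.eq_top_iff' _).2 fun U =>
    mem_of_dense_closure h isClosed_localNormalizer ?_ U)
  rintro _ ((⟨A, -, rfl⟩ | ⟨B, -, rfl⟩) | rfl)
  · exact mem_localNormalizer_of_isLocalProduct ⟨A.1, A.2.1, 1, one_mem _, rfl⟩
  · exact mem_localNormalizer_of_isLocalProduct ⟨1, one_mem _, B.1, B.2.1, rfl⟩
  · exact hV

/-! ### Criteria for universality -/

theorem isUniversal_compositeGates_iff_of_card_ne [Nontrivial m] [Nontrivial n]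
    (hcard : Fintype.card m ≠ Fintype.card n)
    {S : Set (specialUnitaryGroup m ℂ)} {T : Set (specialUnitaryGroup n ℂ)}
    (hS : IsUniversal S) (hT : IsUniversal T) (V : specialUnitaryGroup (m × n) ℂ) :
    IsUniversal (compositeGates S T V) ↔ ¬ IsLocalProduct V.1 :=
  ⟨fun h hV => not_isUniversal_compositeGates (mem_localNormalizer_of_isLocalProduct hV) h,
    fun h => isUniversal_compositeGates_of_not_normalizes hS hT fun hN =>
      h (isLocalProduct_of_normalizes hcard V.2.1 hN)⟩

theorem isUniversal_compositeGates_iff [Nontrivial n]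
    {S T : Set (specialUnitaryGroup n ℂ)} (hS : IsUniversal S) (hT : IsUniversal T)
    (V : specialUnitaryGroup (n × n) ℂ) :
    IsUniversal (compositeGates S T V) ↔ ¬ IsLocalProduct V.1 ∧ ¬ IsLocalProductSwap V.1 := by
  refine ⟨fun h => ⟨fun hV => ?_, fun hV => ?_⟩, fun h => ?_⟩
  · exact not_isUniversal_compositeGates (mem_localNormalizer_of_isLocalProduct hV) h
  · exact not_isUniversal_compositeGates (mem_localNormalizer_of_isLocalProductSwap hV) h
  · exact isUniversal_compositeGates_of_not_normalizes hS hT fun hN =>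
      (isLocalProduct_or_isLocalProductSwap_of_normalizes V.2.1 hN).elim h.1 h.2

/-- In coprime dimensions the phases of the factors of a local product of determinant `1` can be
shifted between the factors so that both have determinant `1`. -/
theorem isLocalProduct_iff_of_coprime (hcop : (Fintype.card m).Coprime (Fintype.card n))
    (V : specialUnitaryGroup (m × n) ℂ) :
    IsLocalProduct V.1 ↔
      ∃ (U₁ : specialUnitaryGroup m ℂ) (U₂ : specialUnitaryGroup n ℂ), V = tensorSU U₁ U₂ := by
  constructor
  · rintro ⟨U₁, h₁, U₂, h₂, hV⟩
    set k := Fintype.card m with hk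
    set l := Fintype.card n with hl
    have hdet : U₁.det ^ l * U₂.det ^ k = 1 := by
      rw [← (mem_specialUnitaryGroup_iff.1 V.2).2, hV, det_kronecker]
    have hd₁ := det_of_mem_unitary h₁
    have hd₂ := det_of_mem_unitary h₂
    set d₁ := U₁.det with hd₁'
    set d₂ := U₂.det with hd₂'
    have h0₁ : d₁ ≠ 0 := left_ne_zero_of_mul_eq_one (Unitary.mem_iff.1 hd₁).2
    have h0₂ : d₂ ≠ 0 := left_ne_zero_of_mul_eq_one (Unitary.mem_iff.1 hd₂).2
    obtain ⟨u, v, huv⟩ : ∃ u v : ℤ, u * k + v * l = 1 := by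
      have := Nat.isCoprime_iff_coprime.2 hcop
      exact this
    -- Bezout's identity makes this the common solution of `c ^ k = d₁⁻¹` and `c ^ l = d₂`.
    set c : ℂ := d₁ ^ (-u) * d₂ ^ v with hc
    have hdz : d₁ ^ (l : ℤ) * d₂ ^ (k : ℤ) = 1 := by exact_mod_cast hdet
    have hck : c ^ k * d₁ = 1 := by
      have h : c ^ k * d₁ = (d₁ ^ (l : ℤ) * d₂ ^ (k : ℤ)) ^ v := by
        rw [hc, mul_pow, mul_zpow, ← zpow_natCast, ← zpow_natCast, ← _root_.zpow_mul,
          ← _root_.zpow_mul, ← _root_.zpow_mul, ← _root_.zpow_mul,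
          mul_right_comm, ← zpow_add_one₀ h0₁]
        congr 2
        · linear_combination -huv
        · ring
      rw [h, hdz, _root_.one_zpow]
    have hcl : c ^ l = d₂ := by
      have h : c ^ l * (d₁ ^ (l : ℤ) * d₂ ^ (k : ℤ)) ^ u = d₂ := by
        rw [hc, mul_pow, mul_zpow, ← zpow_natCast, ← zpow_natCast, ← _root_.zpow_mul,
          ← _root_.zpow_mul, ← _root_.zpow_mul, ← _root_.zpow_mul,
          mul_mul_mul_comm, ← zpow_add₀ h0₁, ← zpow_add₀ h0₂]
        rw [show -u * (l : ℤ) + l * u = 0 by ring, show v * (l : ℤ) + k * u = 1 by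
          linear_combination huv, zpow_zero, zpow_one, one_mul]
      rwa [hdz, _root_.one_zpow, mul_one] at h
    have hn : ∀ z : ℂ, z ∈ unitary ℂ → ‖z‖ = 1 := fun z hz => CStarRing.norm_of_mem_unitary hz
    have hcn : ‖c‖ = 1 := by
      rw [hc, norm_mul, norm_zpow, norm_zpow, hn _ hd₁, hn _ hd₂, _root_.one_zpow, _root_.one_zpow,
        one_mul]
    have hc0 : c ≠ 0 := by rintro h; simp [h] at hcn
    have hcu : c ∈ unitary ℂ := by
      rw [Unitary.mem_iff_self_mul_star]
      simp [Complex.mul_conj', hcn]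
    have hciu : c⁻¹ ∈ unitary ℂ := by
      rw [Unitary.mem_iff_self_mul_star] at hcu ⊢
      rw [star_inv₀, ← mul_inv, hcu, inv_one]
    refine ⟨⟨c • U₁, mem_specialUnitaryGroup_iff.2 ⟨?_, ?_⟩⟩,
      ⟨c⁻¹ • U₂, mem_specialUnitaryGroup_iff.2 ⟨?_, ?_⟩⟩, Subtype.ext ?_⟩
    · exact Unitary.smul_mem_of_mem hcu h₁
    · rw [det_smul, ← hk, hck]
    · exact Unitary.smul_mem_of_mem hciu h₂
    · rw [det_smul, ← hl, inv_pow, hcl, inv_mul_cancel₀ h0₂]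
    · change V.1 = (c • U₁) ⊗ₖ (c⁻¹ • U₂)
      rw [smul_kronecker, kronecker_smul, smul_smul, mul_inv_cancel₀ hc0, one_smul, hV]
  · rintro ⟨U₁, U₂, rfl⟩
    exact ⟨U₁.1, U₁.2.1, U₂.1, U₂.2.1, rfl⟩

end Converse

theorem mainTheorem8 :
    (∀ k l : ℕ, 2 ≤ k → 2 ≤ l → k ≠ l →
      ∀ (S : Set (Matrix.specialUnitaryGroup (Fin k) ℂ))
        (T : Set (Matrix.specialUnitaryGroup (Fin l) ℂ)),
      IsUniversal S → IsUniversal T →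
      ∀ V : Matrix.specialUnitaryGroup (Fin k × Fin l) ℂ,
        (IsUniversal (compositeGates S T V) ↔
          ¬ IsLocalProduct (V : Matrix (Fin k × Fin l) (Fin k × Fin l) ℂ)) ∧
        (Nat.Coprime k l →
          (IsUniversal (compositeGates S T V) ↔
            ¬ ∃ (U₁ : Matrix.specialUnitaryGroup (Fin k) ℂ)
                (U₂ : Matrix.specialUnitaryGroup (Fin l) ℂ), V = tensorSU U₁ U₂))) ∧
    (∀ k : ℕ, 2 ≤ k →
      ∀ S T : Set (Matrix.specialUnitaryGroup (Fin k) ℂ),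
      IsUniversal S → IsUniversal T →
      ∀ V : Matrix.specialUnitaryGroup (Fin k × Fin k) ℂ,
        (IsUniversal (compositeGates S T V) ↔
          ¬ IsLocalProduct (V : Matrix (Fin k × Fin k) (Fin k × Fin k) ℂ) ∧
          ¬ IsLocalProductSwap (V : Matrix (Fin k × Fin k) (Fin k × Fin k) ℂ))) := by
  refine ⟨fun k l hk hl hkl S T hS hT V => ?_, fun k hk S T hS hT V => ?_⟩
  · have : Nontrivial (Fin k) := Fin.nontrivial_iff_two_le.2 hk
    have : Nontrivial (Fin l) := Fin.nontrivial_iff_two_le.2 hl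
    have h := isUniversal_compositeGates_iff_of_card_ne (by simpa using hkl) hS hT V
    refine ⟨h, fun hcop => ?_⟩
    rw [h, isLocalProduct_iff_of_coprime (by simpa using hcop)]
  · have : Nontrivial (Fin k) := Fin.nontrivial_iff_two_le.2 hk
    exact isUniversal_compositeGates_iff hS hT V
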